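/- All multigraphs are finite and loopless. Let $G_3$ denote the triangle $K_3$ with one edge doubled. A multigraph is subcubic if every vertex has degree at most $3$, and it is $k$-edge-colorable if its edges can be assigned colors from $\{1,\dots,k\}$ such that any two distinct edges sharing an end receive different colors. Every connected subcubic multigraph $G=(V,E)$ that is not isomorphic to $G_3$ has a $3$-edge-colorable subgraph with at least $\frac{7}{9}|E|$ edges. Moreover, such a subgraph together with a $3$-edge-coloring of it can be found in polynomial time: there are one algorithm (a random access machine program with addition, truncated subtraction, comparison and indirect addressing at unit cost) and one polynomial $T$ such that, for every such $G$, given by the numbers $|V|$ and $|E|$ and the list of the ends of its edges, the algorithm halts after at most $T(|V|+|E|)$ steps and outputs such a subgraph and a $3$-edge-coloring of it. -/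

import Mathlib

namespace Graph

/-- The degree of a vertex of a multigraph; a loop counts twice. -/
noncomputable def vertexDegree {α β : Type*} (G : Graph α β) (x : α) : ℕ∞ :=
  (G.incidenceSet x).encard + (G.loopSet x).encard

/-- Every vertex has degree at most three. -/
def IsSubcubic {α β : Type*} (G : Graph α β) : Prop :=
  ∀ x ∈ G.vertexSet, G.vertexDegree x ≤ 3

/-- There is a vertex, and any two vertices are joined by a walk. -/
def IsConnected {α β : Type*} (G : Graph α β) : Prop :=
  G.vertexSet.Nonempty ∧
    ∀ x ∈ G.vertexSet, ∀ y ∈ G.vertexSet, Relation.ReflTransGen G.Adj x y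

/-- Isomorphism of multigraphs: compatible bijections of the vertices and of the edges. -/
def IsIsomorphic {α β α' β' : Type*} (G : Graph α β) (H : Graph α' β') : Prop :=
  ∃ (φ : G.vertexSet ≃ H.vertexSet) (ψ : G.edgeSet ≃ H.edgeSet),
    ∀ (e : G.edgeSet) (x y : G.vertexSet),
      G.IsLink e x y ↔ H.IsLink (ψ e) (φ x) (φ y)

/-- `c` assigns to every edge of `G` a color from `{1, …, k}` such that any two distinct edges with
a common end receive different colors. Values of `c` outside the edge set are irrelevant. -/
def IsEdgeColoring {α β : Type*} (G : Graph α β) (k : ℕ) (c : β → ℕ) : Prop :=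
  (∀ e ∈ G.edgeSet, 1 ≤ c e ∧ c e ≤ k) ∧
    ∀ e f : β, e ≠ f → ∀ x : α, G.Inc e x → G.Inc f x → c e ≠ c f

/-- `G` has a proper edge coloring with `k` colors. -/
def IsEdgeColorable {α β : Type*} (G : Graph α β) (k : ℕ) : Prop :=
  ∃ c : β → ℕ, G.IsEdgeColoring k c

end Graph

/-- A finite multigraph given as a list of edges: the vertices are `0, …, n - 1`, the edges are
`0, …, m - 1`, and `ends e` are the two ends of the edge `e`, in either order. -/
structure EdgeList where
  n : ℕ
  m : ℕ
  ends : Fin m → Fin n × Fin n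

namespace EdgeList

/-- The multigraph described by an edge list. -/
def toGraph (I : EdgeList) : Graph (Fin I.n) (Fin I.m) where
  vertexSet := Set.univ
  edgeSet := Set.univ
  IsLink e x y := I.ends e = (x, y) ∨ I.ends e = (y, x)
  isLink_symm := fun _ _ => ⟨fun _ _ h => h.symm⟩
  eq_or_eq_of_isLink_of_isLink := by
    intro e x y v w h h'
    rcases h with h | h <;> rcases h' with h' | h' <;> rw [h] at h' <;>
      simp only [Prod.mk.injEq] at h' <;> simp [h']
  edge_mem_iff_exists_isLink := fun e =>
    ⟨fun _ => ⟨(I.ends e).1, (I.ends e).2, Or.inl rfl⟩, fun _ => Set.mem_univ e⟩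
  left_mem_of_isLink := fun _ x _ _ => Set.mem_univ x

/-- The size of the input: the number of vertices plus the number of edges. -/
def size (I : EdgeList) : ℕ := I.n + I.m

end EdgeList

/-- The triangle with one edge doubled. -/
def graphG3 : Graph (Fin 3) (Fin 4) :=
  EdgeList.toGraph ⟨3, 4, ![(0, 1), (1, 2), (2, 0), (2, 0)]⟩

/-! ### Random access machines with a step count

The machine has registers and finitely many (as many as its program mentions) arrays, all holding
natural numbers. The arithmetic operations are addition and truncated subtraction, so in `t` steps
the stored numbers grow by at most `t` binary digits. -/

namespace RAM

/-- The contents of the registers and of the arrays. -/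
structure State where
  reg : ℕ → ℕ
  arr : ℕ → ℕ → ℕ

/-- Write `v` to register `d`. -/
def State.setReg (s : State) (d v : ℕ) : State :=
  { s with reg := Function.update s.reg d v }

/-- Write `v` to cell `i` of array `a`. -/
def State.setArr (s : State) (a i v : ℕ) : State :=
  { s with arr := Function.update s.arr a (Function.update (s.arr a) i v) }

/-- Tests compare the contents of two registers. -/
inductive Test where
  | eq (x y : ℕ)
  | lt (x y : ℕ)

/-- The test succeeds in the given state. -/
def Test.Holds : Test → State → Prop
  | .eq x y, s => s.reg x = s.reg y
  | .lt x y, s => s.reg x < s.reg y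

/-- Programs. Array names and register names are fixed in the program; array cells are addressed
indirectly, through the content of a register. -/
inductive Prog where
  | skip
  | const (d v : ℕ)
  | add (d x y : ℕ)
  | sub (d x y : ℕ)
  | load (d a i : ℕ)
  | store (a i x : ℕ)
  | seq (p q : Prog)
  | cond (b : Test) (p q : Prog)
  | loop (b : Test) (p : Prog)

/-- `Exec p s s' t`: started in `s`, the program `p` halts in the state `s'` after `t` steps. Every
elementary operation and every evaluation of a test is one step; `loop b p` repeats `p` as long as
`b` succeeds. -/
inductive Exec : Prog → State → State → ℕ → Prop where
  | skip (s : State) : Exec .skip s s 1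
  | const (d v : ℕ) (s : State) : Exec (.const d v) s (s.setReg d v) 1
  | add (d x y : ℕ) (s : State) : Exec (.add d x y) s (s.setReg d (s.reg x + s.reg y)) 1
  | sub (d x y : ℕ) (s : State) : Exec (.sub d x y) s (s.setReg d (s.reg x - s.reg y)) 1
  | load (d a i : ℕ) (s : State) : Exec (.load d a i) s (s.setReg d (s.arr a (s.reg i))) 1
  | store (a i x : ℕ) (s : State) : Exec (.store a i x) s (s.setArr a (s.reg i) (s.reg x)) 1
  | seq {p q : Prog} {s s' s'' : State} {t t' : ℕ} :
      Exec p s s' t → Exec q s' s'' t' → Exec (.seq p q) s s'' (t + t')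
  | cond_true {b : Test} {p q : Prog} {s s' : State} {t : ℕ} :
      b.Holds s → Exec p s s' t → Exec (.cond b p q) s s' (t + 1)
  | cond_false {b : Test} {p q : Prog} {s s' : State} {t : ℕ} :
      ¬ b.Holds s → Exec q s s' t → Exec (.cond b p q) s s' (t + 1)
  | loop_true {b : Test} {p : Prog} {s s' s'' : State} {t t' : ℕ} :
      b.Holds s → Exec p s s' t → Exec (.loop b p) s' s'' t' →
      Exec (.loop b p) s s'' (t + 1 + t')
  | loop_false {b : Test} {p : Prog} {s : State} :
      ¬ b.Holds s → Exec (.loop b p) s s 1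

/-- The initial state on an edge list: register `0` holds the number of vertices, register `1` the
number of edges, and arrays `0` and `1` hold the two ends of every edge. All else is zero. -/
def input (I : EdgeList) : State where
  reg j := if j = 0 then I.n else if j = 1 then I.m else 0
  arr a i :=
    if h : i < I.m then
      if a = 0 then (I.ends ⟨i, h⟩).1 else if a = 1 then (I.ends ⟨i, h⟩).2 else 0
    else 0

/-- The output for the edge `e`: the content of cell `e` of array `2`. -/
def output (I : EdgeList) (s : State) (e : Fin I.m) : ℕ := s.arr 2 e

end RAM

/-! Call a proper partial coloring with three colors locally optimal if it cannot be made cheaper by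
a move of the following kind: uncolor one edge, exchange two colors on one Kempe component, force a
color on each of two edges. The cost counts uncolored edges and breaks ties by the degrees of their
ends. There are polynomially many moves and the cost is polynomially bounded, so local search from
the empty coloring finds a local optimum in polynomial time. It remains to see that a local optimum
leaves at most 2/9 of the edges uncolored (`LocalOpt.nine_mul_card_le`).

Let `uv` be uncolored, with `i` missing at `u` and `j` missing at `v`. Every color occurs at `u` or
`v`, and `u`, `v` are the two ends of one `i`/`j`-path (`LocalOpt.reach`). The uncolored edges form
a matching (`LocalOpt.eq_of_inc`), and the path contains no end of another uncolored edge
(`LocalOpt.reach_avoids`): otherwise cutting the path there would color two edges at the price of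
one.

Now discharge. A vertex `w` has charge `2 * deg w`, in total at most `4|E|`. An uncolored edge takes
the whole charge of its ends. Its arms are the edges at one end whose color is missing at the other;
they are first edges of such paths. The far end of an arm therefore meets no uncolored edge and
serves at most two uncolored edges; it gives 3 to each of two, or everything to a single one. Every
uncolored edge then receives at least 18 (`LocalOpt.le_sum_charge`). Its end degrees are 3, 3 or 3,
2. For 3, 3 two arm ends give 6+6+3+3, and if they coincide, the tie-break in the cost forces degree
3 there, giving 6+6+6. For 3, 2 there are three arms, and the count fails only if all of them end at
one vertex, which makes the component a `G_3`. Hence 18 times the number of uncolored edges is at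
most `4|E|`.

The remainder verifies a program for this local search. The existence statement for abstract
multigraphs follows by transport to an edge list. -/

/-- A loopless multigraph given by the two ends of every edge. -/
structure EndMap (V E : Type*) where
  fst : E → V
  snd : E → V
  ne : ∀ e, fst e ≠ snd e

/-! ### Partial edge colorings and Kempe exchanges -/

namespace EndMap

variable {V E : Type*} (G : EndMap V E)

/-- The edge `e` joins `x` and `y`. -/
def Link (e : E) (x y : V) : Prop :=
  (G.fst e = x ∧ G.snd e = y) ∨ (G.fst e = y ∧ G.snd e = x)

/-- The vertex `x` is an end of the edge `e`. -/
def Inc (e : E) (x : V) : Prop := G.fst e = x ∨ G.snd e = x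

/-- A proper partial edge coloring with the colors `1, 2, 3`; the color `0` means uncolored. -/
def Proper (c : E → ℕ) : Prop :=
  (∀ e, c e ≤ 3) ∧ ∀ e f x, e ≠ f → G.Inc e x → G.Inc f x → c e = c f → c e = 0

/-- No edge at `x` has the color `k`. -/
def Lacks (c : E → ℕ) (x : V) (k : ℕ) : Prop := ∀ e, G.Inc e x → c e ≠ k

/-- Two vertices are joined by an edge of color `i` or `j`. -/
def Step (c : E → ℕ) (i j : ℕ) (x y : V) : Prop := ∃ e, G.Link e x y ∧ (c e = i ∨ c e = j)

/-- Two vertices belong to the same Kempe component for the colors `i` and `j`. -/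
def Reach (c : E → ℕ) (i j : ℕ) : V → V → Prop := Relation.ReflTransGen (G.Step c i j)

open Classical in
/-- Give the edge `t` the color `a` and uncolor all other edges of this color touching `t`. -/
noncomputable def force (c : E → ℕ) (t : E) (a : ℕ) : E → ℕ := fun g =>
  if g = t then a else if c g = a ∧ (G.Inc g (G.fst t) ∨ G.Inc g (G.snd t)) then 0 else c g

open Classical in
/-- Exchange the colors `i` and `j` on the edges whose first end belongs to `K`. -/
noncomputable def swapOn (c : E → ℕ) (K : V → Prop) (i j : ℕ) : E → ℕ := fun g =>
  if K (G.fst g) then Equiv.swap i j (c g) else c g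

open Classical in
/-- The result of uncoloring `g`, exchanging `i` and `j` on the Kempe component of `x` and forcing
two colors on two edges. -/
noncomputable def cand (c : E → ℕ) (g : E) (x : V) (i j : ℕ) (e : E) (a : ℕ) (f : E) (b : ℕ) :
    E → ℕ :=
  G.force (G.force (G.swapOn (Function.update c g 0)
    (G.Reach (Function.update c g 0) i j x) i j) e a) f b

variable {G} {c : E → ℕ} {e f g h : E} {x y z u v w : V} {i j k : ℕ}

theorem Link.symm (h : G.Link e x y) : G.Link e y x := Or.symm h
theorem Link.left (h : G.Link e x y) : G.Inc e x := by unfold Link Inc at *; tauto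
theorem Link.right (h : G.Link e x y) : G.Inc e y := h.symm.left
theorem Link.ne (h : G.Link e x y) : x ≠ y := by
  have := G.ne e; unfold Link at h; grind
theorem Link.inc_iff (h : G.Link e x y) : G.Inc e z ↔ z = x ∨ z = y := by
  unfold Link Inc at *; grind
theorem Link.right_unique {x' : V} (h1 : G.Link h x w) (h2 : G.Link h x' w) : x = x' := by
  have := h1.ne
  have := (h1.inc_iff.1 h2.left)
  have := h2.ne
  tauto

theorem Inc.exists_link (h : G.Inc e x) : ∃ y, G.Link e x y := by
  rcases h with h | h
  · exact ⟨_, Or.inl ⟨h, rfl⟩⟩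
  · exact ⟨_, Or.inr ⟨rfl, h⟩⟩
theorem link_ends (e : E) : G.Link e (G.fst e) (G.snd e) := Or.inl ⟨rfl, rfl⟩

theorem Step.symm (h : G.Step c i j x y) : G.Step c i j y x :=
  let ⟨e, he, hc⟩ := h; ⟨e, he.symm, hc⟩

theorem Reach.symm (h : G.Reach c i j x y) : G.Reach c i j y x := by
  induction h with
  | refl => exact .refl
  | tail _ h ih => exact .head h.symm ih

theorem Reach.trans (h : G.Reach c i j x y) (h' : G.Reach c i j y z) : G.Reach c i j x z :=
  Relation.ReflTransGen.trans h h'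

theorem Reach.comm (h : G.Reach c i j x y) : G.Reach c j i x y :=
  Relation.ReflTransGen.mono (fun _ _ ⟨e, he, hc⟩ => ⟨e, he, hc.symm⟩) _ _ h

theorem Link.reach (h : G.Link e x y) (hc : c e = i ∨ c e = j) : G.Reach c i j x y :=
  .single ⟨e, h, hc⟩

theorem exists_of_not_lacks (h : ¬ G.Lacks c x k) : ∃ e, G.Inc e x ∧ c e = k := by
  unfold Lacks at h; push Not at h; exact h

/-- A vertex with neither of two colors is alone in its Kempe component. -/
theorem Reach.eq_of_lacks (h : G.Reach c i j x y) (hi : G.Lacks c x i) (hj : G.Lacks c x j) :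
    x = y := by
  rcases Relation.ReflTransGen.cases_head h with h | ⟨_, ⟨e, he, hc⟩, _⟩
  · exact h
  · rcases hc with hc | hc
    · exact absurd hc (hi e he.left)
    · exact absurd hc (hj e he.left)

section DecidableEdges
variable [DecidableEq E]

theorem Lacks.uncolor (h : G.Lacks c x k) (hk : k ≠ 0) : G.Lacks (Function.update c g 0) x k := by
  intro e he
  by_cases heg : e = g
  · subst heg; simpa using hk.symm
  · simpa [heg] using h e he

theorem Proper.uncolor (h : G.Proper c) : G.Proper (Function.update c g 0) := by
  refine ⟨fun e => ?_, fun e f x hef he hf hc => ?_⟩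
  · by_cases heg : e = g <;> simp [heg, h.1 e]
  · by_cases heg : e = g
    · simp [heg]
    · by_cases hfg : f = g
      · subst hfg; simpa [heg] using hc
      · simp only [Function.update_of_ne heg, Function.update_of_ne hfg] at hc ⊢
        exact h.2 e f x hef he hf hc

theorem Proper.lacks_uncolor (h : G.Proper c) (hg : G.Inc g x) (hk : c g ≠ 0) :
    G.Lacks (Function.update c g 0) x (c g) := by
  intro e he
  by_cases heg : e = g
  · subst heg; simpa using hk.symm
  · simp only [Function.update_of_ne heg]
    intro hc
    exact hk (hc ▸ h.2 e g x heg he hg hc)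

theorem Reach.of_uncolor (hi : i ≠ 0) (hj : j ≠ 0)
    (h : G.Reach (Function.update c g 0) i j x y) : G.Reach c i j x y := by
  refine Relation.ReflTransGen.mono (fun a b ⟨e, he, hc⟩ => ⟨e, he, ?_⟩) _ _ h
  by_cases heg : e = g
  · subst heg; simp at hc; omega
  · simpa [heg] using hc

/-- What is reachable before the removal of an edge is reachable from one of its ends after it. -/
theorem Reach.uncolor_or (hg : G.Link g x y) (h : G.Reach c i j x z) :
    G.Reach (Function.update c g 0) i j x z ∨ G.Reach (Function.update c g 0) i j y z := by
  induction h with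
  | refl => exact .inl .refl
  | @tail a b _ hab ih =>
    obtain ⟨e, he, hc⟩ := hab
    by_cases heg : e = g
    · subst heg
      have := he.inc_iff.1 hg.left
      have := he.inc_iff.1 hg.right
      have := hg.ne
      have hb : b = x ∨ b = y := hg.inc_iff.1 he.right
      rcases hb with rfl | rfl
      · exact .inl .refl
      · exact .inr .refl
    · have hs : G.Step (Function.update c g 0) i j a b := ⟨e, he, by simpa [heg] using hc⟩
      exact ih.imp (fun h => h.tail hs) (fun h => h.tail hs)

/-- A Kempe component has at most two ends. -/
theorem Proper.not_three_ends [Fintype E] (hc : G.Proper c) (hi : i ≠ 0) (hj : j ≠ 0)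
    (hxy : x ≠ y) (hxz : x ≠ z) (hyz : y ≠ z) (h1 : G.Reach c i j x y) (h2 : G.Reach c i j x z)
    (hx : G.Lacks c x i ∨ G.Lacks c x j) (hy : G.Lacks c y i ∨ G.Lacks c y j)
    (hz : G.Lacks c z i ∨ G.Lacks c z j) : False := by
  -- Peel the component from its end `x`: there is only one edge `g` of color `i` or `j` at `x`.
  -- After its removal `x` is isolated, and the neighbor `x'` takes over the role of the third end.
  induction hn : (Finset.univ.filter fun e => c e = i ∨ c e = j).card using Nat.strong_induction_on
    generalizing c x with
  | _ n ih =>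
    obtain ⟨x', ⟨g, hg, hgc⟩, -⟩ :=
      (Relation.ReflTransGen.cases_head h1).resolve_left hxy
    set d := Function.update c g 0 with hd
    have hg0 : c g ≠ 0 := by rcases hgc with h | h <;> rw [h] <;> assumption
    have hdx : G.Lacks d x i ∧ G.Lacks d x j := by
      have := hc.lacks_uncolor hg.left hg0
      rcases hgc with h | h <;> rw [h] at this
      · exact ⟨this, (hx.resolve_left fun h' => h' g hg.left h).uncolor hj⟩
      · exact ⟨(hx.resolve_right fun h' => h' g hg.left h).uncolor hi, this⟩
    have hdx' : G.Lacks d x' i ∨ G.Lacks d x' j := by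
      have := hc.lacks_uncolor hg.right hg0
      rcases hgc with h | h <;> rw [h] at this
      · exact .inl this
      · exact .inr this
    have hy' : G.Lacks d y i ∨ G.Lacks d y j := hy.imp (·.uncolor hi) (·.uncolor hj)
    have hz' : G.Lacks d z i ∨ G.Lacks d z j := hz.imp (·.uncolor hi) (·.uncolor hj)
    have h1' : G.Reach d i j x' y := (h1.uncolor_or hg).resolve_left fun h =>
      hxy (h.eq_of_lacks hdx.1 hdx.2)
    have h2' : G.Reach d i j x' z := (h2.uncolor_or hg).resolve_left fun h =>
      hxz (h.eq_of_lacks hdx.1 hdx.2)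
    -- If `x'` is one of the other two ends, the removal isolates it as well, although it should
    -- still reach the remaining end.
    have key : ∀ {w : V}, (G.Lacks c w i ∨ G.Lacks c w j) → x' = w →
        G.Lacks d w i ∧ G.Lacks d w j := by
      rintro w hw rfl
      have := hc.lacks_uncolor hg.right hg0
      rcases hgc with h | h <;> rw [h] at this
      · exact ⟨this, (hw.resolve_left fun h' => h' g hg.right h).uncolor hj⟩
      · exact ⟨(hw.resolve_right fun h' => h' g hg.right h).uncolor hi, this⟩
    by_cases hxy' : x' = y
    · obtain ⟨a, b⟩ := key hy hxy'
      subst hxy'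
      exact hyz (h2'.eq_of_lacks a b)
    by_cases hxz' : x' = z
    · obtain ⟨a, b⟩ := key hz hxz'
      subst hxz'
      exact hxy' (h1'.eq_of_lacks a b)
    refine ih _ ?_ hc.uncolor hxy' hxz' h1' h2' hdx' hy' hz' rfl
    rw [← hn]
    refine Finset.card_lt_card ⟨fun e he => ?_, fun h => ?_⟩
    · simp only [Finset.mem_filter, Finset.mem_univ, true_and] at he ⊢
      by_cases heg : e = g
      · subst heg; exact hgc
      · simpa [hd, heg] using he
    · have := h (by simpa using hgc : g ∈ Finset.univ.filter fun e => c e = i ∨ c e = j)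
      simp at this; omega

end DecidableEdges

/-- An edge colored `i` or `j` has both ends in `K` or both outside, so testing its first end
suffices, and at each vertex the colors are permuted uniformly. Edges of other colors are fixed by
the exchange wherever they lie. -/
theorem swapOn_proper (hc : G.Proper c) (hi : i ∈ Set.Icc 1 3) (hj : j ∈ Set.Icc 1 3) {K : V → Prop}
    (hK : ∀ x y, G.Step c i j x y → (K x ↔ K y)) : G.Proper (G.swapOn c K i j) := by
  obtain ⟨hi1, hi3⟩ := hi
  obtain ⟨hj1, hj3⟩ := hj
  have hKe : ∀ e x, G.Inc e x → (c e = i ∨ c e = j) → (K (G.fst e) ↔ K x) := by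
    rintro e x (h | h) hce
    · rw [h]
    · exact hK _ _ ⟨e, .inl ⟨rfl, h⟩, hce⟩
  have hval : ∀ e x, G.Inc e x → G.swapOn c K i j e = Equiv.swap i j (c e) ∧ K x ∨
      G.swapOn c K i j e = c e ∧ ¬ K x ∨ (c e ≠ i ∧ c e ≠ j ∧ G.swapOn c K i j e = c e) := by
    intro e x he
    by_cases h : c e = i ∨ c e = j
    · have := hKe e x he h
      unfold swapOn
      split_ifs with h' <;> tauto
    · push Not at h
      refine .inr (.inr ⟨h.1, h.2, ?_⟩)
      unfold swapOn
      split_ifs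
      · exact Equiv.swap_apply_of_ne_of_ne h.1 h.2
      · rfl
  refine ⟨fun e => ?_, fun e f x hef he hf hcc => ?_⟩
  · have := hc.1 e
    unfold swapOn
    split_ifs
    · rw [Equiv.swap_apply_def]; split_ifs <;> omega
    · exact this
  · have := hc.2 e f x hef he hf
    have h1 := hval e x he
    have h2 := hval f x hf
    simp only [Equiv.swap_apply_def] at h1 h2
    grind

theorem swapOn_eq_zero (hi : i ≠ 0) (hj : j ≠ 0) {K : V → Prop} :
    G.swapOn c K i j e = 0 ↔ c e = 0 := by
  unfold swapOn
  split_ifs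
  · rw [Equiv.swap_apply_def]; split_ifs <;> omega
  · rfl

theorem step_reach_iff (h : G.Step c i j y z) : G.Reach c i j x y ↔ G.Reach c i j x z :=
  ⟨fun h' => h'.tail h, fun h' => h'.tail h.symm⟩

/-- The effect of a Kempe exchange on the missing colors. -/
theorem lacks_swapOn_iff {K : V → Prop}
    (hK : ∀ x y, G.Step c i j x y → (K x ↔ K y)) :
    G.Lacks (G.swapOn c K i j) x k ↔
      (K x ∧ G.Lacks c x (Equiv.swap i j k)) ∨ (¬ K x ∧ G.Lacks c x k) := by
  have hval : ∀ e, G.Inc e x → (G.swapOn c K i j e = k ↔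
      (K x ∧ c e = Equiv.swap i j k) ∨ (¬ K x ∧ c e = k)) := by
    intro e he
    have hKe : (c e = i ∨ c e = j) → (K (G.fst e) ↔ K x) := by
      intro hce
      rcases he with h | h
      · rw [h]
      · exact hK _ _ ⟨e, .inl ⟨rfl, h⟩, hce⟩
    unfold swapOn
    simp only [Equiv.swap_apply_def]
    grind
  unfold Lacks
  constructor
  · intro h
    by_cases hx : K x
    · exact .inl ⟨hx, fun e he hce => h e he ((hval e he).2 (.inl ⟨hx, hce⟩))⟩
    · exact .inr ⟨hx, fun e he hce => h e he ((hval e he).2 (.inr ⟨hx, hce⟩))⟩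
  · rintro h e he hce
    rcases (hval e he).1 hce with ⟨h1, h2⟩ | ⟨h1, h2⟩
    · rcases h with h | h
      · exact h.2 e he h2
      · exact h.1 h1
    · rcases h with h | h
      · exact h1 h.1
      · exact h.2 e he h2

/-- Every conflict that the new color creates is removed by uncoloring the other edge, so no
assumption on `e` is needed. -/
theorem force_proper (hc : G.Proper c) (hk : k ≤ 3) : G.Proper (G.force c e k) := by
  refine ⟨fun f => ?_, fun f g x hfg hf hg hcc => ?_⟩
  · have := hc.1 f
    unfold force
    split_ifs <;> omega
  · have h1 : ∀ y, G.Inc e y → (y = G.fst e ∨ y = G.snd e) := by unfold Inc; grind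
    have := hc.2 f g x hfg hf hg
    unfold force at *
    have := h1 x
    grind

theorem force_of_lacks [DecidableEq E] (he : G.Link e x y) (hx : G.Lacks c x k)
    (hy : G.Lacks c y k) : G.force c e k = Function.update c e k := by
  funext f
  unfold force
  by_cases hf : f = e
  · simp [hf]
  · rw [if_neg hf, if_neg, Function.update_of_ne hf]
    rintro ⟨h1, h2⟩
    rcases he with ⟨rfl, rfl⟩ | ⟨rfl, rfl⟩
    · rcases h2 with h2 | h2
      · exact hx f h2 h1
      · exact hy f h2 h1
    · rcases h2 with h2 | h2
      · exact hy f h2 h1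
      · exact hx f h2 h1

theorem swapOn_self {K : V → Prop} : G.swapOn c K i i = c := by
  funext e; simp [swapOn]

/-- With this, a candidate, which forces two edges, also covers the moves that force only one. -/
theorem force_force {a : ℕ} : G.force (G.force c e a) e a = G.force c e a := by
  funext f; unfold force; grind

/-- By properness `h` is the only edge of its color at `u`, and there is none at `v`. So forcing
displaces `h` alone: the hole in the coloring moves from `e` to `h`. -/
theorem force_of_link [DecidableEq E] (hc : G.Proper c) (he : c e = 0) (hl : G.Link e u v)
    (hh : G.Link h u w) (hv : G.Lacks c v (c h)) (h0 : c h ≠ 0) :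
    G.force c e (c h) = Function.update (Function.update c h 0) e (c h) := by
  have hne : h ≠ e := by rintro rfl; exact h0 he
  funext f
  unfold force
  by_cases hf : f = e
  · subst hf; simp
  rw [if_neg hf, Function.update_of_ne hf]
  by_cases hfh : f = h
  · subst hfh
    rw [if_pos, Function.update_self]
    refine ⟨rfl, ?_⟩
    rcases hl with ⟨rfl, -⟩ | ⟨-, rfl⟩
    · exact .inl hh.left
    · exact .inr hh.left
  · rw [if_neg, Function.update_of_ne hfh]
    rintro ⟨h1, h2⟩
    have h3 : G.Inc f u ∨ G.Inc f v := by
      rcases hl with ⟨rfl, rfl⟩ | ⟨rfl, rfl⟩ <;> tauto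
    rcases h3 with h3 | h3
    · exact h0 (h1 ▸ hc.2 f h u hfh h3 hh.left h1)
    · exact hv f h3 h1

/-- Candidates are proper for all parameters, which spares the search any test of validity. -/
theorem cand_proper (hc : G.Proper c) (hi : i ∈ Set.Icc 1 3) (hj : j ∈ Set.Icc 1 3) {a b : ℕ}
    (ha : a ≤ 3) (hb : b ≤ 3) : G.Proper (G.cand c g x i j e a f b) := by
  classical
  refine force_proper (force_proper (swapOn_proper ?_ hi hj fun _ _ => step_reach_iff) ha) hb
  exact hc.uncolor

end EndMap

/-! ### Locally optimal colorings -/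

namespace EndMap

variable {V E : Type*} [Fintype E] (G : EndMap V E)

open Classical in
/-- The number of edges at a vertex. -/
noncomputable def deg (x : V) : ℕ := (Finset.univ.filter fun e => G.Inc e x).card

/-- The uncolored edges. -/
def uncolored (c : E → ℕ) : Finset E := Finset.univ.filter fun e => c e = 0

/-- The cost of a partial coloring: few uncolored edges are wanted, and among the colorings with the
same number of them, those that have uncolored edges at vertices of small degree. -/
noncomputable def cost (c : E → ℕ) : ℕ :=
  ∑ e ∈ uncolored c, (6 * Fintype.card E + 1 + (G.deg (G.fst e) + G.deg (G.snd e)))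

/-- No candidate is cheaper than the proper coloring `c`. -/
structure LocalOpt (c : E → ℕ) : Prop where
  proper : G.Proper c
  -- Isolated `x` are excluded because the vertex type is `ℕ` in the application, while the search
  -- visits only `x < n`.
  opt : ∀ (g : E) (x : V) (i j : ℕ) (e : E) (a : ℕ) (f : E) (b : ℕ), (∃ h, G.Inc h x) →
    i ∈ Set.Icc 1 3 → j ∈ Set.Icc 1 3 → a ∈ Set.Icc 1 3 → b ∈ Set.Icc 1 3 →
    G.cost c ≤ G.cost (G.cand c g x i j e a f b)

variable {G} {c : E → ℕ} {e f g : E} {x y z u v w : V} {i j k : ℕ}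

theorem mem_uncolored : e ∈ uncolored c ↔ c e = 0 := by simp [uncolored]

/-- The degree terms add up to at most `6|E|`, less than the fixed price `6|E| + 1` of one uncolored
edge, so they only break ties. -/
theorem cost_lt_of_card_lt (hG : ∀ x, G.deg x ≤ 3) {c' : E → ℕ}
    (h : (uncolored c').card < (uncolored c).card) : G.cost c' < G.cost c := by
  have h1 : G.cost c' ≤ (uncolored c').card * (6 * Fintype.card E + 1 + 6) := by
    refine Finset.sum_le_card_nsmul _ _ _ fun e _ => ?_
    have := hG (G.fst e); have := hG (G.snd e); omega
  have h2 : (uncolored c).card * (6 * Fintype.card E + 1) ≤ G.cost c :=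
    Finset.card_nsmul_le_sum (uncolored c) _ (6 * Fintype.card E + 1) fun e _ => by omega
  have h3 : (uncolored c').card ≤ Fintype.card E := Finset.card_le_univ _
  nlinarith

/-- The colors at a vertex, and the number of uncolored edges there. -/
theorem card_colors_add_le (s : Finset ℕ) (t : Finset E)
    (hs : ∀ k ∈ s, k ≠ 0 ∧ ¬ G.Lacks c x k) (ht : ∀ e ∈ t, c e = 0 ∧ G.Inc e x) :
    s.card + t.card ≤ G.deg x := by
  classical
  have h1 : s ⊆ (Finset.univ.filter fun e => G.Inc e x ∧ c e ≠ 0).image c := by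
    intro k hk
    obtain ⟨e, he, rfl⟩ := exists_of_not_lacks (hs k hk).2
    exact Finset.mem_image_of_mem _ (by simpa [he] using (hs _ hk).1)
  refine (Nat.add_le_add_right ((Finset.card_le_card h1).trans Finset.card_image_le) _).trans ?_
  rw [← Finset.card_union_of_disjoint]
  · refine Finset.card_le_card fun e he => ?_
    simp only [Finset.mem_union, Finset.mem_filter, Finset.mem_univ, true_and] at he ⊢
    exact he.elim (·.1) fun h => (ht e h).2
  · rw [Finset.disjoint_left]
    intro e he he'
    simp only [Finset.mem_filter] at he
    exact he.2.2 (ht e he').1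

/-- The ends of an uncolored edge lack a color. -/
theorem exists_lacks (hG : ∀ x, G.deg x ≤ 3) (he : c e = 0)
    (hx : G.Inc e x) : ∃ k ∈ Set.Icc 1 3, G.Lacks c x k := by
  by_contra! h
  have := card_colors_add_le (x := x) {1, 2, 3} {e}
    (by intro k hk; simp at hk; rcases hk with rfl | rfl | rfl <;> exact ⟨by simp, h _ (by simp)⟩)
    (by simp [he, hx])
  have := hG x
  simp at *
  omega

/-- A vertex has no more than three edges. -/
theorem mem_of_three (hG : G.deg x ≤ 3) {e₁ e₂ e₃ : E} (h1 : G.Inc e₁ x) (h2 : G.Inc e₂ x)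
    (h3 : G.Inc e₃ x) (h12 : e₁ ≠ e₂) (h13 : e₁ ≠ e₃) (h23 : e₂ ≠ e₃) (h : G.Inc e x) :
    e = e₁ ∨ e = e₂ ∨ e = e₃ := by
  classical
  by_contra! hne
  have : ({e, e₁, e₂, e₃} : Finset E).card ≤ G.deg x := by
    refine Finset.card_le_card fun f hf => ?_
    simp only [Finset.mem_insert, Finset.mem_singleton] at hf
    rcases hf with rfl | rfl | rfl | rfl <;> simpa
  rw [Finset.card_insert_of_notMem (by simp; tauto), Finset.card_insert_of_notMem (by simp; tauto),
    Finset.card_insert_of_notMem (by simp; tauto)] at this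
  simp at this
  omega

theorem mem_of_two (hG : G.deg x ≤ 2) {e₁ e₂ : E} (h1 : G.Inc e₁ x) (h2 : G.Inc e₂ x)
    (h12 : e₁ ≠ e₂) (h : G.Inc e x) : e = e₁ ∨ e = e₂ := by
  classical
  by_contra! hne
  have : ({e, e₁, e₂} : Finset E).card ≤ G.deg x := by
    refine Finset.card_le_card fun f hf => ?_
    simp only [Finset.mem_insert, Finset.mem_singleton] at hf
    rcases hf with rfl | rfl | rfl <;> simpa
  rw [Finset.card_insert_of_notMem (by simp; tauto), Finset.card_insert_of_notMem (by simp; tauto)]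
    at this
  simp at this
  omega

theorem two_le_deg {e₁ e₂ : E} (h1 : G.Inc e₁ x) (h2 : G.Inc e₂ x)
    (h12 : e₁ ≠ e₂) : 2 ≤ G.deg x := by
  classical
  rw [← Finset.card_pair h12]
  refine Finset.card_le_card fun f hf => ?_
  simp only [Finset.mem_insert, Finset.mem_singleton] at hf
  rcases hf with rfl | rfl <;> simpa

theorem three_le_deg {e₁ e₂ e₃ : E} (h1 : G.Inc e₁ x) (h2 : G.Inc e₂ x) (h3 : G.Inc e₃ x)
    (h12 : e₁ ≠ e₂) (h13 : e₁ ≠ e₃) (h23 : e₂ ≠ e₃) : 3 ≤ G.deg x := by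
  classical
  have : ({e₁, e₂, e₃} : Finset E).card ≤ G.deg x := by
    refine Finset.card_le_card fun f hf => ?_
    simp only [Finset.mem_insert, Finset.mem_singleton] at hf
    rcases hf with rfl | rfl | rfl <;> simpa
  rwa [Finset.card_insert_of_notMem (by simp; tauto), Finset.card_pair h23] at this

theorem uncolored_update [DecidableEq E] (hk : k ≠ 0) :
    uncolored (Function.update c e k) = (uncolored c).erase e := by
  ext f
  by_cases h : f = e
  · subst h; simp [mem_uncolored, hk]
  · simp [mem_uncolored, h]

theorem uncolored_update_zero [DecidableEq E] :
    uncolored (Function.update c e 0) = insert e (uncolored c) := by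
  ext f
  by_cases h : f = e
  · subst h; simp [mem_uncolored]
  · simp [mem_uncolored, h]

theorem uncolored_swapOn {K : V → Prop} (hi : i ≠ 0) (hj : j ≠ 0) :
    uncolored (G.swapOn c K i j) = uncolored c := by
  ext f; simp [mem_uncolored, swapOn_eq_zero hi hj]

theorem ne_zero_of_mem (hi : i ∈ Set.Icc 1 3) : i ≠ 0 := by
  have := hi.1; omega

namespace LocalOpt

/-- This is the candidate with void uncoloring (`e` is already uncolored), void exchange (of 1 with
1) and twice the same forcing. -/
theorem cost_force_le (hc : G.LocalOpt c) (he : c e = 0) (hk : k ∈ Set.Icc 1 3) :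
    G.cost c ≤ G.cost (G.force c e k) := by
  classical
  have h1 := hc.opt e (G.fst e) 1 1 e k e k ⟨e, (link_ends e).left⟩ (by simp) (by simp) hk hk
  have h2 : Function.update c e 0 = c := by rw [← he, Function.update_eq_self]
  unfold cand at h1
  rw [swapOn_self, force_force] at h1
  rw [h2] at h1
  exact h1

/-- Every color occurs at one of the ends of an uncolored edge. -/
theorem not_lacks_of_lacks (hc : G.LocalOpt c) (hG : ∀ x, G.deg x ≤ 3) (he : c e = 0)
    (hl : G.Link e x y) (hk : k ∈ Set.Icc 1 3) (hx : G.Lacks c x k) : ¬ G.Lacks c y k := by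
  classical
  intro hy
  have h1 := hc.cost_force_le he hk
  rw [force_of_lacks hl hx hy] at h1
  refine absurd h1 (not_le.2 (cost_lt_of_card_lt hG ?_))
  rw [uncolored_update (ne_zero_of_mem hk)]
  exact Finset.card_erase_lt_of_mem (mem_uncolored.2 he)

theorem ne_of_lacks (hc : G.LocalOpt c) (hG : ∀ x, G.deg x ≤ 3) (he : c e = 0)
    (hl : G.Link e x y) (hi : i ∈ Set.Icc 1 3) (hx : G.Lacks c x i) (hy : G.Lacks c y j) :
    i ≠ j := by
  rintro rfl; exact hc.not_lacks_of_lacks hG he hl hi hx hy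

/-- The ends of an uncolored edge are in a common Kempe component. -/
theorem reach (hc : G.LocalOpt c) (hG : ∀ x, G.deg x ≤ 3) (he : c e = 0) (hl : G.Link e x y)
    (hi : i ∈ Set.Icc 1 3) (hj : j ∈ Set.Icc 1 3) (hx : G.Lacks c x i) (hy : G.Lacks c y j) :
    G.Reach c i j x y := by
  classical
  by_contra hn
  -- If `y` were outside the component of `x`, exchanging the colors there would make `j` missing at
  -- both ends, and `e` could be colored.
  have h1 := hc.opt e x i j e j e j ⟨e, hl.left⟩ hi hj hj hj
  have h2 : Function.update c e 0 = c := by rw [← he, Function.update_eq_self]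
  unfold cand at h1
  rw [force_force] at h1
  have hK : ∀ y z, G.Step c i j y z → (G.Reach c i j x y ↔ G.Reach c i j x z) :=
    fun _ _ => step_reach_iff
  rw [h2, force_of_lacks hl ((lacks_swapOn_iff hK).2 (.inl ⟨.refl, by simpa using hx⟩))
    ((lacks_swapOn_iff hK).2 (.inr ⟨hn, hy⟩))] at h1
  refine absurd h1 (not_le.2 (cost_lt_of_card_lt hG ?_))
  rw [uncolored_update (ne_zero_of_mem hj), uncolored_swapOn (ne_zero_of_mem hi)
    (ne_zero_of_mem hj)]
  exact Finset.card_erase_lt_of_mem (mem_uncolored.2 he)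

/-- The uncolored edges form a matching. -/
theorem eq_of_inc (hc : G.LocalOpt c) (hG : ∀ x, G.deg x ≤ 3) (he : c e = 0) (hf : c f = 0)
    (hex : G.Inc e x) (hfx : G.Inc f x) : e = f := by
  classical
  by_contra hef
  obtain ⟨a, ha⟩ := hex.exists_link
  obtain ⟨b, hb⟩ := hfx.exists_link
  -- Two of the at most three edges at `x` are uncolored, so at most one color occurs at `x`. The
  -- colors missing at `a` and at `b` both occur at `x`, hence are equal.
  have hx : ∀ p q, p ∈ Set.Icc 1 3 → q ∈ Set.Icc 1 3 → ¬ G.Lacks c x p → ¬ G.Lacks c x q →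
      p = q := by
    intro p q hp hq hp' hq'
    by_contra hpq
    have := card_colors_add_le (G := G) (c := c) (x := x) {p, q} {e, f}
      (by simp [hp', hq', ne_zero_of_mem hp, ne_zero_of_mem hq]) (by simp [*])
    rw [Finset.card_pair hpq, Finset.card_pair hef] at this
    have := hG x
    omega
  obtain ⟨p, hp, hap⟩ := exists_lacks hG he ha.right
  obtain ⟨p', hp', hbp⟩ := exists_lacks hG hf hb.right
  have hxp := hc.not_lacks_of_lacks hG he ha.symm hp hap
  have hxp' := hc.not_lacks_of_lacks hG hf hb.symm hp' hbp
  obtain rfl := hx p p' hp hp' hxp hxp'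
  obtain ⟨q, hq, hxq⟩ := exists_lacks hG he hex
  have hqp : q ≠ p := by rintro rfl; exact hxp hxq
  by_cases hab : a = b
  · subst hab
    -- two uncolored edges with the same ends
    obtain ⟨r, hr, hrp, hrq⟩ : ∃ r ∈ Set.Icc 1 3, r ≠ p ∧ r ≠ q := by
      have := hp.1; have := hp.2; have := hq.1; have := hq.2
      by_cases h1 : p ≠ 1 ∧ q ≠ 1
      · exact ⟨1, by simp, by omega, by omega⟩
      by_cases h2 : p ≠ 2 ∧ q ≠ 2
      · exact ⟨2, by simp, by omega, by omega⟩
      · exact ⟨3, by simp, by omega, by omega⟩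
    have hxr : G.Lacks c x r := by
      by_contra h
      exact hrp (hx r p hr hp h hxp)
    have haq := hc.not_lacks_of_lacks hG he ha hq hxq
    have har := hc.not_lacks_of_lacks hG he ha hr hxr
    have := card_colors_add_le (G := G) (c := c) (x := a) {q, r} {e, f}
      (by simp [haq, har, ne_zero_of_mem hq, ne_zero_of_mem hr]) (by simp [he, hf, ha.right, hb.right])
    rw [Finset.card_pair hrq.symm, Finset.card_pair hef] at this
    have := hG a
    omega
  -- Both edges put their ends in a common `p`/`q`-component, so `x`, `a`, `b` would be three ends
  -- of it.
  · have h1 := hc.reach hG he ha.symm hp hq hap hxq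
    have h2 := hc.reach hG hf hb.symm hp hq hbp hxq
    exact hc.proper.not_three_ends (ne_zero_of_mem hp) (ne_zero_of_mem hq) ha.ne hb.ne hab
      h1.symm h2.symm (.inr hxq) (.inl hap) (.inl hbp)

/-- The component already has the ends `u` and `v`, so `z` is an inner vertex of the path. -/
theorem not_lacks_of_reach (hc : G.LocalOpt c) (hG : ∀ x, G.deg x ≤ 3)
    (he : c e = 0) (hl : G.Link e u v) (hi : i ∈ Set.Icc 1 3) (hj : j ∈ Set.Icc 1 3)
    (hu : G.Lacks c u i) (hv : G.Lacks c v j) (hz : G.Reach c i j u z) (hzu : u ≠ z)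
    (hzv : v ≠ z) : ¬ G.Lacks c z i ∧ ¬ G.Lacks c z j := by
  classical
  have hr := hc.reach hG he hl hi hj hu hv
  have := fun h => hc.proper.not_three_ends (ne_zero_of_mem hi) (ne_zero_of_mem hj) hl.ne hzu hzv
    hr hz (.inl hu) (.inr hv) h
  tauto

/-- Let `g` be the edge of color `j` at the inner vertex `z` of the path from `u` to `v`. Uncoloring
`g` cuts the path. An exchange on the piece behind `g` makes a color missing at both `u` and `v`, so
`e` can be colored; `f` gets the color `j`, which `z` has just lost. Two edges are gained for one.
-/
theorem reach_avoids_aux (hc : G.LocalOpt c) (hG : ∀ x, G.deg x ≤ 3)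
    (he : c e = 0) (hf : c f = 0) (hef : e ≠ f) (hl : G.Link e u v) (hi : i ∈ Set.Icc 1 3)
    (hj : j ∈ Set.Icc 1 3) (hu : G.Lacks c u i) (hv : G.Lacks c v j)
    (hz : G.Reach c i j u z) (hlf : G.Link f z y) (hy : G.Lacks c y j) : False := by
  classical
  have hi0 := ne_zero_of_mem hi
  have hj0 := ne_zero_of_mem hj
  have huz : u ≠ z := by rintro rfl; exact hef (hc.eq_of_inc hG he hf hl.left hlf.left)
  have hvz : v ≠ z := by rintro rfl; exact hef (hc.eq_of_inc hG he hf hl.right hlf.left)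
  have huy : u ≠ y := by rintro rfl; exact hef (hc.eq_of_inc hG he hf hl.left hlf.right)
  have hvy : v ≠ y := by rintro rfl; exact hef (hc.eq_of_inc hG he hf hl.right hlf.right)
  have huv := hc.reach hG he hl hi hj hu hv
  obtain ⟨g, hgz, hgj⟩ := exists_of_not_lacks
    (hc.not_lacks_of_reach hG he hl hi hj hu hv hz huz hvz).2
  obtain ⟨z', hg⟩ := hgz.exists_link
  have hg0 : c g ≠ 0 := by rw [hgj]; exact hj0
  set d := Function.update c g 0 with hd
  have hdp : G.Proper d := hc.proper.uncolor
  have hdz : G.Lacks d z j := hgj ▸ hc.proper.lacks_uncolor hg.left hg0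
  have hdz' : G.Lacks d z' j := hgj ▸ hc.proper.lacks_uncolor hg.right hg0
  have hdu : G.Lacks d u i := hu.uncolor hi0
  have hdv : G.Lacks d v j := hv.uncolor hj0
  have hdy : G.Lacks d y j := hy.uncolor hj0
  have hzz' : G.Reach c i j z z' := hg.reach (.inr hgj)
  -- Since `y` lacks `j` and is neither `u` nor `v`, it does not lie on the path at all.
  have hny : ¬ G.Reach d i j z' y := fun h =>
    (hc.not_lacks_of_reach hG he hl hi hj hu hv
      ((hz.trans hzz').trans (h.of_uncolor hi0 hj0)) huy hvy).2 hy
  -- The removal of `g` really cuts the path: otherwise `z`, which now lacks `j`, would be a third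
  -- end besides `u` and `v`. The next two claims show that exactly one of `u`, `v` lies in the
  -- piece of `z'`.
  have hnz : ¬ G.Reach d i j z' z := by
    intro h
    have h1 : ∀ w, G.Reach c i j z w → G.Reach d i j z w := fun w hw =>
      (hw.uncolor_or hg).elim id fun h' => h.symm.trans h'
    exact hdp.not_three_ends hi0 hj0 huz.symm hvz.symm hl.ne (h1 u hz.symm)
      (h1 v (hz.symm.trans huv)) (.inr hdz) (.inl hdu) (.inr hdv)
  have hor : G.Reach d i j z' u ∨ G.Reach d i j z' v := by
    by_contra! h
    exact hdp.not_three_ends hi0 hj0 huz.symm hvz.symm hl.ne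
      ((hz.symm.uncolor_or hg).resolve_right h.1)
      (((hz.symm.trans huv).uncolor_or hg).resolve_right h.2) (.inr hdz) (.inl hdu) (.inr hdv)
  have hnot : ¬ (G.Reach d i j z' u ∧ G.Reach d i j z' v) := by
    rintro ⟨h1, h2⟩
    have hz'v : z' ≠ v := by rintro rfl; exact hv g hg.right hgj
    by_cases hz'u : z' = u
    · subst hz'u
      exact hz'v (h2.eq_of_lacks hdu hdz')
    · exact hdp.not_three_ends hi0 hj0 hz'u hz'v hl.ne h1 h2 (.inr hdz') (.inl hdu) (.inr hdv)
  set K := G.Reach d i j z' with hKdef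
  have hK : ∀ y z, G.Step d i j y z → (K y ↔ K z) := fun _ _ => step_reach_iff
  set d' := G.swapOn d K i j with hd'
  -- The end in the exchanged piece trades its missing color for that of the other end: `a` is `j`
  -- if this is `u`, and `i` if it is `v`.
  obtain ⟨a, ha, hua, hva⟩ : ∃ a ∈ Set.Icc 1 3, G.Lacks d' u a ∧ G.Lacks d' v a := by
    rcases hor with h | h
    · refine ⟨j, hj, (lacks_swapOn_iff hK).2 (.inl ⟨h, by simpa using hdu⟩),
        (lacks_swapOn_iff hK).2 (.inr ⟨fun h' => hnot ⟨h, h'⟩, hdv⟩)⟩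
    · refine ⟨i, hi, (lacks_swapOn_iff hK).2 (.inr ⟨fun h' => hnot ⟨h', h⟩, hdu⟩),
        (lacks_swapOn_iff hK).2 (.inl ⟨h, by simpa using hdv⟩)⟩
  have hlacks : ∀ w, u ≠ w → v ≠ w → G.Lacks d' w j → G.Lacks (Function.update d' e a) w j := by
    intro w h1 h2 h h' hw
    by_cases hh : h' = e
    · subst hh
      rcases hl.inc_iff.1 hw with rfl | rfl
      · exact absurd rfl h1
      · exact absurd rfl h2
    · rw [Function.update_of_ne hh]
      exact h h' hw
  have h1 := hc.opt g z' i j e a f j ⟨g, hg.right⟩ hi hj ha hj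
  unfold cand at h1
  rw [← hd, ← hKdef, ← hd', force_of_lacks hl hua hva, force_of_lacks hlf
    (hlacks z huz hvz ((lacks_swapOn_iff hK).2 (.inr ⟨hnz, hdz⟩)))
    (hlacks y huy hvy ((lacks_swapOn_iff hK).2 (.inr ⟨hny, hdy⟩)))] at h1
  refine absurd h1 (not_le.2 (cost_lt_of_card_lt hG ?_))
  rw [uncolored_update hj0, uncolored_update (ne_zero_of_mem ha), uncolored_swapOn hi0 hj0,
    uncolored_update_zero]
  have hge : g ≠ e := by rintro rfl; exact hg0 he
  have hgf : g ≠ f := by rintro rfl; exact hg0 hf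
  have he' := mem_uncolored.2 he
  have hf' := mem_uncolored.2 hf
  rw [Finset.card_erase_of_mem (by simp [hef.symm, hf']), Finset.card_erase_of_mem (by simp [he']),
    Finset.card_insert_of_notMem (by simpa [mem_uncolored] using hg0)]
  have := Finset.card_pos.2 ⟨e, he'⟩
  omega

/-- The Kempe components of the ends of an uncolored edge contain no ends of other uncolored
edges. -/
theorem reach_avoids (hc : G.LocalOpt c) (hG : ∀ x, G.deg x ≤ 3)
    (he : c e = 0) (hf : c f = 0) (hl : G.Link e u v) (hi : i ∈ Set.Icc 1 3)
    (hj : j ∈ Set.Icc 1 3) (hu : G.Lacks c u i) (hv : G.Lacks c v j)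
    (hz : G.Reach c i j u z) (hfz : G.Inc f z) : f = e := by
  classical
  by_contra hef
  obtain ⟨y, hlf⟩ := hfz.exists_link
  obtain ⟨k, hk, hyk⟩ := exists_lacks hG hf hlf.right
  -- The auxiliary lemma needs the far end of `f` to lack one of the two path colors; for `i` it
  -- applies with `u` and `v` interchanged.
  by_cases hkj : k = j
  · subst hkj
    exact hc.reach_avoids_aux hG he hf (Ne.symm hef) hl hi hj hu hv hz hlf hyk
  by_cases hki : k = i
  · subst hki
    exact hc.reach_avoids_aux hG he hf (Ne.symm hef) hl.symm hj hi hv hu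
      ((hc.reach hG he hl hi hj hu hv).symm.trans hz).comm hlf hyk
  have huz : u ≠ z := by rintro rfl; exact hef (hc.eq_of_inc hG hf he hlf.left hl.left)
  have hvz : v ≠ z := by rintro rfl; exact hef (hc.eq_of_inc hG hf he hlf.left hl.right)
  obtain ⟨h1, h2⟩ := hc.not_lacks_of_reach hG he hl hi hj hu hv hz huz hvz
  have h3 := hc.not_lacks_of_lacks hG hf hlf.symm hk hyk
  have hij := hc.ne_of_lacks hG he hl hi hu hv
  -- With a third color `k`, all three colors and the uncolored edge `f` meet at `z`, too many for
  -- degree 3.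
  have := card_colors_add_le (G := G) (c := c) (x := z) {k, i, j} {f}
    (by simp [h1, h2, h3, ne_zero_of_mem hi, ne_zero_of_mem hj, ne_zero_of_mem hk])
    (by simp [hf, hfz])
  rw [Finset.card_insert_of_notMem (by simp [hki, hkj]), Finset.card_pair hij] at this
  have := hG z
  rw [Finset.card_singleton] at *
  omega

end LocalOpt

end EndMap

/-! ### The discharging argument -/

namespace EndMap

variable {V E : Type*} [Fintype E] (G : EndMap V E)

/-- The edge `h` leads from the end `x` of the edge `e = xy` to `w`, and its color does not occur at
the end `y`. -/
structure Arm (c : E → ℕ) (e : E) (x y : V) (h : E) (w : V) : Prop where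
  link : G.Link e x y
  arm : G.Link h x w
  lacks : G.Lacks c y (c h)
  color : c h ∈ Set.Icc 1 3

/-- The vertex `w` is at the end of an arm of `e`. -/
def Dem (c : E → ℕ) (e : E) (w : V) : Prop := ∃ x y h, G.Arm c e x y h w

open Classical in
/-- The charge that the uncolored edge `e` receives from the vertex `w`. -/
noncomputable def charge (c : E → ℕ) (e : E) (w : V) : ℕ :=
  if G.Inc e w then 2 * G.deg w
  else if G.Dem c e w then
    if ∃ e', c e' = 0 ∧ e' ≠ e ∧ G.Dem c e' w then 3 else 2 * G.deg w
  else 0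

/-- Some component is a triangle with one edge doubled. -/
def HasG3 : Prop :=
  ∃ u v w e h₀ h₁ h₂, G.Link e u v ∧ G.Link h₀ v w ∧ G.Link h₁ w u ∧ G.Link h₂ w u ∧ h₁ ≠ h₂ ∧
    ∀ f, G.Inc f u ∨ G.Inc f v ∨ G.Inc f w → f = e ∨ f = h₀ ∨ f = h₁ ∨ f = h₂

variable {G} {c : E → ℕ} {e f g h : E} {x y z u v w : V} {i j k : ℕ}

namespace LocalOpt

/-- `w` lies on the path of `e`, where only `e` itself could be uncolored. But `w` is not `x`, and
it is not `y`, which lacks the color of the arm. -/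
theorem arm_free (hc : G.LocalOpt c) (hG : ∀ x, G.deg x ≤ 3) (he : c e = 0)
    (ha : G.Arm c e x y h w) (hf : c f = 0) : ¬ G.Inc f w := by
  intro hfw
  obtain ⟨i, hi, hx⟩ := exists_lacks (G := G) hG he ha.link.left
  have hr : G.Reach c i (c h) x w := ha.arm.reach (.inr rfl)
  obtain rfl := hc.reach_avoids hG he hf ha.link hi ha.color hx ha.lacks hr hfw
  rcases ha.link.inc_iff.1 hfw with rfl | rfl
  · exact ha.arm.ne rfl
  · exact ha.lacks h ha.arm.right rfl

/-- `w` is an inner vertex of the path of `e`, so the path goes on with an edge of color `i`. Its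
next vertex is still on the path and thus meets no other uncolored edge; hence `h'` cannot be an arm
of another uncolored edge. -/
theorem arm_next (hc : G.LocalOpt c) (hG : ∀ x, G.deg x ≤ 3) (he : c e = 0)
    (ha : G.Arm c e x y h w) (hi : i ∈ Set.Icc 1 3) (hx : G.Lacks c x i) :
    ∃ h', G.Inc h' w ∧ c h' = i ∧ h' ≠ h ∧
      ∀ z f, G.Link h' z w → c f = 0 → G.Inc f z → f = e := by
  have hr : G.Reach c i (c h) x w := ha.arm.reach (.inr rfl)
  have hyw : y ≠ w := by rintro rfl; exact ha.lacks h ha.arm.right rfl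
  obtain ⟨h', hh', rfl⟩ := exists_of_not_lacks
    (hc.not_lacks_of_reach hG he ha.link hi ha.color hx ha.lacks hr ha.arm.ne hyw).1
  refine ⟨h', hh', rfl, ?_, fun z f hz hf hfz => ?_⟩
  · rintro rfl; exact hx _ ha.arm.left rfl
  · exact hc.reach_avoids hG he hf ha.link hi ha.color hx ha.lacks
      (hr.trans (hz.symm.reach (.inl rfl))) hfz

theorem two_le_deg_of_dem (hc : G.LocalOpt c) (hG : ∀ x, G.deg x ≤ 3) (he : c e = 0)
    (hd : G.Dem c e w) : 2 ≤ G.deg w := by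
  obtain ⟨x, y, h, ha⟩ := hd
  obtain ⟨i, hi, hx⟩ := exists_lacks (G := G) hG he ha.link.left
  obtain ⟨h', hh', -, hne, -⟩ := hc.arm_next hG he ha hi hx
  exact two_le_deg hh' ha.arm.right hne

/-- A vertex is at the end of arms of at most two uncolored edges. -/
theorem dem_dem (hc : G.LocalOpt c) (hG : ∀ x, G.deg x ≤ 3) {e₀ e₁ : E} (h0 : c e₀ = 0)
    (h1 : c e₁ = 0) (hne : e₀ ≠ e₁) (hd0 : G.Dem c e₀ w) (hd1 : G.Dem c e₁ w) :
    3 ≤ G.deg w ∧ ∀ e, c e = 0 → G.Dem c e w → e = e₀ ∨ e = e₁ := by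
  obtain ⟨x, y, h, ha⟩ := hd0
  obtain ⟨x₁, y₁, g, hb⟩ := hd1
  obtain ⟨i, hi, hx⟩ := exists_lacks (G := G) hG h0 ha.link.left
  obtain ⟨h', hh', -, hne', hz⟩ := hc.arm_next hG h0 ha hi hx
  -- The arm of `e₁` is neither `h` nor the continuation `h'` of the path of `e₀`. So these three
  -- are all the edges at `w`, and only `h` and `g` leave room for arms of distinct uncolored edges.
  have hgh : g ≠ h := by
    rintro rfl
    obtain rfl := hb.arm.right_unique ha.arm
    exact hne (hc.eq_of_inc hG h0 h1 ha.link.left hb.link.left)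
  have hgh' : g ≠ h' := by
    rintro rfl
    exact hne (hz _ _ hb.arm h1 hb.link.left).symm
  refine ⟨three_le_deg ha.arm.right hh' hb.arm.right hne'.symm hgh.symm hgh'.symm, ?_⟩
  rintro e he ⟨x₂, y₂, h₂, hd⟩
  rcases mem_of_three (hG w) ha.arm.right hh' hb.arm.right hne'.symm hgh.symm hgh'.symm
    hd.arm.right with rfl | rfl | rfl
  · obtain rfl := hd.arm.right_unique ha.arm
    exact .inl (hc.eq_of_inc hG he h0 hd.link.left ha.link.left)
  · exact .inl (hz _ _ hd.arm he hd.link.left)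
  · obtain rfl := hd.arm.right_unique hb.arm
    exact .inr (hc.eq_of_inc hG he h1 hd.link.left hb.link.left)

/-- A vertex with two edges to the ends of an uncolored edge is at the end of arms of no other
uncolored edge. -/
theorem eq_of_dem (hc : G.LocalOpt c) (hG : ∀ x, G.deg x ≤ 3) {h₁ h₂ : E} {x₁ x₂ : V}
    (he : c e = 0) (hf : c f = 0) (hd : G.Dem c f w) (hl1 : G.Link h₁ x₁ w) (hl2 : G.Link h₂ x₂ w)
    (hne : h₁ ≠ h₂) (he1 : G.Inc e x₁) (he2 : G.Inc e x₂) : f = e := by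
  obtain ⟨x, y, h, ha⟩ := hd
  by_cases hh1 : h = h₁
  · subst hh1
    obtain rfl := ha.arm.right_unique hl1
    exact hc.eq_of_inc hG hf he ha.link.left he1
  by_cases hh2 : h = h₂
  · subst hh2
    obtain rfl := ha.arm.right_unique hl2
    exact hc.eq_of_inc hG hf he ha.link.left he2
  obtain ⟨i, hi, hx⟩ := exists_lacks (G := G) hG hf ha.link.left
  obtain ⟨h', hh', -, hne', hz⟩ := hc.arm_next hG hf ha hi hx
  rcases mem_of_three (hG w) ha.arm.right hl1.right hl2.right hh1 hh2 hne hh' with rfl | rfl | rfl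
  · exact absurd rfl hne'
  · exact (hz _ _ hl1 he he1).symm
  · exact (hz _ _ hl2 he he2).symm

theorem sum_charge_le (hc : G.LocalOpt c) (hG : ∀ x, G.deg x ≤ 3) (w : V) :
    ∑ e ∈ uncolored c, G.charge c e w ≤ 2 * G.deg w := by
  classical
  by_cases h1 : ∃ e, c e = 0 ∧ G.Inc e w
  · obtain ⟨e, he, hew⟩ := h1
    rw [Finset.sum_eq_single_of_mem e (mem_uncolored.2 he)]
    · simp [charge, hew]
    · intro f hf hfe
      have hf := mem_uncolored.1 hf
      have h2 : ¬ G.Inc f w := fun h => hfe (hc.eq_of_inc hG hf he h hew)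
      have h3 : ¬ G.Dem c f w := fun ⟨x, y, h, ha⟩ => hc.arm_free hG hf ha he hew
      simp [charge, h2, h3]
  push Not at h1
  by_cases h2 : ∃ e, c e = 0 ∧ G.Dem c e w
  swap
  · push Not at h2
    rw [Finset.sum_eq_zero]
    · exact Nat.zero_le _
    · intro e he
      have he := mem_uncolored.1 he
      simp [charge, h1 e he, h2 e he]
  obtain ⟨e, he, hd⟩ := h2
  by_cases h3 : ∃ f, c f = 0 ∧ f ≠ e ∧ G.Dem c f w
  · obtain ⟨f, hf, hfe, hdf⟩ := h3
    obtain ⟨h4, h5⟩ := hc.dem_dem hG he hf hfe.symm hd hdf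
    rw [← Finset.sum_subset (s₁ := {e, f})]
    · rw [Finset.sum_pair hfe.symm]
      have h6 : G.charge c e w = 3 := by
        unfold charge
        rw [if_neg (h1 e he), if_pos hd, if_pos ⟨f, hf, hfe, hdf⟩]
      have h7 : G.charge c f w = 3 := by
        unfold charge
        rw [if_neg (h1 f hf), if_pos hdf, if_pos ⟨e, he, hfe.symm, hd⟩]
      omega
    · intro a ha
      simp only [Finset.mem_insert, Finset.mem_singleton] at ha
      rcases ha with rfl | rfl <;> simpa [mem_uncolored]
    · intro a ha ha'
      have ha := mem_uncolored.1 ha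
      have : ¬ G.Dem c a w := fun h => ha' (by simpa using h5 a ha h)
      simp [charge, h1 a ha, this]
  · rw [Finset.sum_eq_single_of_mem e (mem_uncolored.2 he)]
    · simp [charge, h1 e he, hd, h3]
    · intro f hf hfe
      have hf := mem_uncolored.1 hf
      have : ¬ G.Dem c f w := fun h => h3 ⟨f, hf, hfe, h⟩
      simp [charge, h1 f hf, this]

theorem three_le_charge (hc : G.LocalOpt c) (hG : ∀ x, G.deg x ≤ 3) (he : c e = 0)
    (hd : G.Dem c e w) : 3 ≤ G.charge c e w := by
  have h1 : ¬ G.Inc e w := by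
    obtain ⟨x, y, h, ha⟩ := hd
    exact hc.arm_free hG he ha he
  have := hc.two_le_deg_of_dem hG he hd
  unfold charge
  rw [if_neg h1, if_pos hd]
  split_ifs <;> omega

theorem charge_eq (hc : G.LocalOpt c) (hG : ∀ x, G.deg x ≤ 3) {h₁ h₂ : E} {x₁ x₂ : V}
    (he : c e = 0) (hd : G.Dem c e w) (hl1 : G.Link h₁ x₁ w) (hl2 : G.Link h₂ x₂ w)
    (hne : h₁ ≠ h₂) (he1 : G.Inc e x₁) (he2 : G.Inc e x₂) : G.charge c e w = 2 * G.deg w := by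
  unfold charge
  by_cases h : G.Inc e w
  · rw [if_pos h]
  rw [if_neg h, if_pos hd, if_neg]
  rintro ⟨f, hf, hfe, hdf⟩
  exact hfe (hc.eq_of_dem hG he hf hdf hl1 hl2 hne he1 he2)

/-- Moving the hole from `e = uv` to `h = uw` keeps the number of uncolored edges. Optimality
therefore compares the degrees of `v` and `w`; this is the purpose of the tie-break in the cost. -/
theorem deg_le_of_arm (hc : G.LocalOpt c) (he : c e = 0) (ha : G.Arm c e u v h w) :
    G.deg v ≤ G.deg w := by
  classical
  have h0 := ne_zero_of_mem ha.color
  have h1 := hc.cost_force_le he ha.color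
  have hne : h ≠ e := by rintro rfl; exact h0 he
  rw [force_of_link hc.proper he ha.link ha.arm ha.lacks h0] at h1
  unfold cost at h1
  rw [uncolored_update h0, uncolored_update_zero, Finset.erase_insert_of_ne hne,
    Finset.sum_insert (by simp [mem_uncolored, h0]),
    ← Finset.add_sum_erase _ _ (mem_uncolored.2 he)] at h1
  have h2 : ∀ {e x y}, G.Link e x y → G.deg (G.fst e) + G.deg (G.snd e) = G.deg x + G.deg y := by
    rintro e x y (⟨rfl, rfl⟩ | ⟨rfl, rfl⟩)
    · rfl
    · exact add_comm _ _
  rw [h2 ha.link, h2 ha.arm] at h1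
  omega

/-- At `v` there is only one colored edge, its color `p` is the one missing at `u`, and the other
two colors occur at `u`. So all three colored edges at `u` and `v` are arms, and the ends contribute
6 + 4. -/
theorem row_aux (hc : G.LocalOpt c) (hG : ∀ x, G.deg x ≤ 3) (hG3 : ¬ G.HasG3) {S : Finset V}
    (hS : ∀ e x, G.Inc e x → x ∈ S) (he : c e = 0) (hl : G.Link e u v) (hu : G.deg u = 3)
    (hv : G.deg v = 2) : 18 ≤ ∑ w ∈ S, G.charge c e w := by
  classical
  obtain ⟨p, hp, hup⟩ := exists_lacks (G := G) hG he hl.left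
  obtain ⟨q, r, hq, hr, hqr, hqp, hrp⟩ : ∃ q r, q ∈ Set.Icc 1 3 ∧ r ∈ Set.Icc 1 3 ∧ q ≠ r ∧
      q ≠ p ∧ r ≠ p := by
    obtain ⟨h1, h2⟩ := hp
    interval_cases p
    · exact ⟨2, 3, by simp⟩
    · exact ⟨1, 3, by simp⟩
    · exact ⟨1, 2, by simp⟩
  have hvp := hc.not_lacks_of_lacks hG he hl hp hup
  have hvl : ∀ q ∈ Set.Icc 1 3, q ≠ p → G.Lacks c v q := by
    intro q hq hqp
    by_contra hvq
    have := card_colors_add_le (G := G) (c := c) (x := v) {p, q} {e}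
      (by simp [hvp, hvq, ne_zero_of_mem hp, ne_zero_of_mem hq]) (by simp [he, hl.right])
    rw [Finset.card_pair hqp.symm, Finset.card_singleton] at this
    omega
  have hvq := hvl q hq hqp
  have hvr := hvl r hr hrp
  obtain ⟨h₀, hh0, rfl⟩ := exists_of_not_lacks hvp
  obtain ⟨h₁, hh1, rfl⟩ := exists_of_not_lacks (hc.not_lacks_of_lacks hG he hl.symm hq hvq)
  obtain ⟨h₂, hh2, rfl⟩ := exists_of_not_lacks (hc.not_lacks_of_lacks hG he hl.symm hr hvr)
  obtain ⟨w₀, hl0⟩ := hh0.exists_link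
  obtain ⟨w₁, hl1⟩ := hh1.exists_link
  obtain ⟨w₂, hl2⟩ := hh2.exists_link
  have a0 : G.Arm c e v u h₀ w₀ := ⟨hl.symm, hl0, hup, hp⟩
  have a1 : G.Arm c e u v h₁ w₁ := ⟨hl, hl1, hvq, hq⟩
  have a2 : G.Arm c e u v h₂ w₂ := ⟨hl, hl2, hvr, hr⟩
  have d0 : G.Dem c e w₀ := ⟨_, _, _, a0⟩
  have d1 : G.Dem c e w₁ := ⟨_, _, _, a1⟩
  have d2 : G.Dem c e w₂ := ⟨_, _, _, a2⟩
  have hne : ∀ w, G.Dem c e w → u ≠ w ∧ v ≠ w := by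
    rintro w ⟨x, y, h, ha⟩
    have h1 := hc.arm_free hG he ha he
    exact ⟨fun h => h1 (h ▸ hl.left), fun h => h1 (h ▸ hl.right)⟩
  have hcu : G.charge c e u = 6 := by unfold charge; rw [if_pos hl.left, hu]
  have hcv : G.charge c e v = 4 := by unfold charge; rw [if_pos hl.right, hv]
  have h01 : h₀ ≠ h₁ := by rintro rfl; exact hqp rfl
  have h02 : h₀ ≠ h₂ := by rintro rfl; exact hrp rfl
  have h12 : h₁ ≠ h₂ := by rintro rfl; exact hqr rfl
  -- If two arms share their far end, this vertex gives 6 and the third arm 3, so the total is 6 + 4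
  -- + 6 + 3.
  have two : ∀ {w w'}, G.Dem c e w → G.Dem c e w' → w ≠ w' → G.charge c e w = 6 →
      18 ≤ ∑ w ∈ S, G.charge c e w := by
    intro w w' hw hw' hww' h6
    have h7 := hc.three_le_charge hG he hw'
    have hsub : ({u, v, w, w'} : Finset V) ⊆ S := by
      obtain ⟨_, _, _, ha⟩ := hw
      obtain ⟨_, _, _, ha'⟩ := hw'
      simp only [Finset.insert_subset_iff, Finset.singleton_subset_iff]
      exact ⟨hS e u hl.left, hS e v hl.right, hS _ _ ha.arm.right, hS _ _ ha'.arm.right⟩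
    refine le_trans ?_ (Finset.sum_le_sum_of_subset hsub)
    rw [Finset.sum_insert (by simp [hl.ne, hne w hw, hne w' hw']),
      Finset.sum_insert (by simp [hne w hw, hne w' hw']), Finset.sum_pair hww', hcu, hcv]
    omega
  -- A vertex shared by two arms gives its whole charge. It has degree 3: the path through one of
  -- the arms can be chosen to continue with the color of neither.
  by_cases e01 : w₀ = w₁
  · subst e01
    obtain ⟨h', hh', hcol, -⟩ := hc.arm_next hG he a0 hr hvr
    have : 3 ≤ G.deg w₀ := three_le_deg hl0.right hl1.right hh' h01
      (by rintro rfl; exact hrp hcol.symm) (by rintro rfl; exact hqr hcol)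
    have h6 := hc.charge_eq hG he d0 hl0 hl1 h01 hl.right hl.left
    have := hG w₀
    by_cases e02 : w₀ = w₂
    · subst e02
      -- All three arms meet, and the degrees leave no further edges: this is the exceptional
      -- component.
      refine absurd ⟨u, v, w₀, e, h₀, h₁, h₂, hl, hl0, hl1.symm, hl2.symm, h12, ?_⟩ hG3
      have he0 : e ≠ h₀ := by rintro rfl; exact ne_zero_of_mem hp he
      have he1 : e ≠ h₁ := by rintro rfl; exact ne_zero_of_mem hq he
      have he2 : e ≠ h₂ := by rintro rfl; exact ne_zero_of_mem hr he
      rintro f (hf | hf | hf)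
      · have := mem_of_three (hG u) hl.left hl1.left hl2.left he1 he2 h12 hf
        tauto
      · have := mem_of_two hv.le hl.right hl0.left he0 hf
        tauto
      · have := mem_of_three (hG w₀) hl0.right hl1.right hl2.right h01 h02 h12 hf
        tauto
    · exact two d0 d2 e02 (by omega)
  by_cases e02 : w₀ = w₂
  · subst e02
    obtain ⟨h', hh', hcol, -⟩ := hc.arm_next hG he a0 hq hvq
    have : 3 ≤ G.deg w₀ := three_le_deg hl0.right hl2.right hh' h02
      (by rintro rfl; exact hqp hcol.symm) (by rintro rfl; exact hqr hcol.symm)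
    have h6 := hc.charge_eq hG he d0 hl0 hl2 h02 hl.right hl.left
    have := hG w₀
    exact two d0 d1 e01 (by omega)
  by_cases e12 : w₁ = w₂
  · subst e12
    obtain ⟨h', hh', hcol, -⟩ := hc.arm_next hG he a1 hp hup
    have : 3 ≤ G.deg w₁ := three_le_deg hl1.right hl2.right hh' h12
      (by rintro rfl; exact hqp hcol) (by rintro rfl; exact hrp hcol)
    have h6 := hc.charge_eq hG he d1 hl1 hl2 h12 hl.left hl.left
    have := hG w₁
    exact two d1 d0 (Ne.symm e01) (by omega)
  have h6 := hc.three_le_charge hG he d0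
  have h7 := hc.three_le_charge hG he d1
  have h8 := hc.three_le_charge hG he d2
  have hsub : ({u, v, w₀, w₁, w₂} : Finset V) ⊆ S := by
    simp only [Finset.insert_subset_iff, Finset.singleton_subset_iff]
    exact ⟨hS e u hl.left, hS e v hl.right, hS _ _ hl0.right, hS _ _ hl1.right, hS _ _ hl2.right⟩
  refine le_trans ?_ (Finset.sum_le_sum_of_subset hsub)
  rw [Finset.sum_insert (by simp [hl.ne, hne _ d0, hne _ d1, hne _ d2]),
    Finset.sum_insert (by simp [hne _ d0, hne _ d1, hne _ d2]), Finset.sum_insert (by simp [*]),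
    Finset.sum_pair e12, hcu, hcv]
  omega

/-- Every uncolored edge receives a large charge. -/
theorem le_sum_charge (hc : G.LocalOpt c) (hG : ∀ x, G.deg x ≤ 3) (hG3 : ¬ G.HasG3) {S : Finset V}
    (hS : ∀ e x, G.Inc e x → x ∈ S) (he : c e = 0) : 18 ≤ ∑ w ∈ S, G.charge c e w := by
  classical
  obtain ⟨u, v, hl⟩ : ∃ u v, G.Link e u v := ⟨_, _, link_ends e⟩
  obtain ⟨i, hi, hui⟩ := exists_lacks (G := G) hG he hl.left
  obtain ⟨j, hj, hvj⟩ := exists_lacks (G := G) hG he hl.right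
  -- Each of the three colors occurs at `u` or at `v`, and `e` counts at both.
  have h5 : 5 ≤ G.deg u + G.deg v := by
    have h1 := card_colors_add_le (G := G) (c := c) (x := u)
      (({1, 2, 3} : Finset ℕ).filter fun k => ¬ G.Lacks c u k) {e}
      (by intro k hk; simp at hk; exact ⟨by omega, hk.2⟩) (by simp [he, hl.left])
    have h2 := card_colors_add_le (G := G) (c := c) (x := v)
      (({1, 2, 3} : Finset ℕ).filter fun k => G.Lacks c u k) {e}
      (by
        intro k hk
        simp at hk
        exact ⟨by omega, hc.not_lacks_of_lacks hG he hl
          ⟨by omega, by omega⟩ hk.2⟩) (by simp [he, hl.right])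
    have h3 := Finset.card_filter_add_card_filter_not (s := ({1, 2, 3} : Finset ℕ))
      (fun k => G.Lacks c u k)
    simp only [Finset.card_singleton] at h1 h2
    have h4 : ({1, 2, 3} : Finset ℕ).card = 3 := rfl
    omega
  have hu3 := hG u
  have hv3 := hG v
  by_cases hv : G.deg v = 2
  · exact hc.row_aux hG hG3 hS he hl (by omega) hv
  by_cases hu : G.deg u = 2
  · exact hc.row_aux hG hG3 hS he hl.symm (by omega) hu
  have hij := hc.ne_of_lacks hG he hl hi hui hvj
  obtain ⟨h₁, hh1, rfl⟩ := exists_of_not_lacks (hc.not_lacks_of_lacks hG he hl.symm hj hvj)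
  obtain ⟨h₂, hh2, rfl⟩ := exists_of_not_lacks (hc.not_lacks_of_lacks hG he hl hi hui)
  obtain ⟨w₁, hl1⟩ := hh1.exists_link
  obtain ⟨w₂, hl2⟩ := hh2.exists_link
  have a1 : G.Arm c e u v h₁ w₁ := ⟨hl, hl1, hvj, hj⟩
  have a2 : G.Arm c e v u h₂ w₂ := ⟨hl.symm, hl2, hui, hi⟩
  have d1 : G.Dem c e w₁ := ⟨_, _, _, a1⟩
  have d2 : G.Dem c e w₂ := ⟨_, _, _, a2⟩
  have hne : ∀ w, G.Dem c e w → u ≠ w ∧ v ≠ w := by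
    rintro w ⟨x, y, h, ha⟩
    have h1 := hc.arm_free hG he ha he
    exact ⟨fun h => h1 (h ▸ hl.left), fun h => h1 (h ▸ hl.right)⟩
  have hcu : G.charge c e u = 6 := by unfold charge; rw [if_pos hl.left]; omega
  have hcv : G.charge c e v = 6 := by unfold charge; rw [if_pos hl.right]; omega
  have h12 : h₁ ≠ h₂ := by rintro rfl; exact hij rfl
  by_cases e12 : w₁ = w₂
  · subst e12
    -- The shared vertex serves no other uncolored edge, and the tie-break gives it degree 3: 6 + 6
    -- + 6.
    have h6 := hc.charge_eq hG he d1 hl1 hl2 h12 hl.left hl.right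
    have h7 := hc.deg_le_of_arm he a1
    have hsub : ({u, v, w₁} : Finset V) ⊆ S := by
      simp only [Finset.insert_subset_iff, Finset.singleton_subset_iff]
      exact ⟨hS e u hl.left, hS e v hl.right, hS _ _ hl1.right⟩
    refine le_trans ?_ (Finset.sum_le_sum_of_subset hsub)
    rw [Finset.sum_insert (by simp [hl.ne, hne _ d1]), Finset.sum_pair (hne _ d1).2, hcu, hcv]
    omega
  · have h6 := hc.three_le_charge hG he d1
    have h7 := hc.three_le_charge hG he d2
    have hsub : ({u, v, w₁, w₂} : Finset V) ⊆ S := by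
      simp only [Finset.insert_subset_iff, Finset.singleton_subset_iff]
      exact ⟨hS e u hl.left, hS e v hl.right, hS _ _ hl1.right, hS _ _ hl2.right⟩
    refine le_trans ?_ (Finset.sum_le_sum_of_subset hsub)
    rw [Finset.sum_insert (by simp [hl.ne, hne _ d1, hne _ d2]),
      Finset.sum_insert (by simp [hne _ d1, hne _ d2]), Finset.sum_pair e12, hcu, hcv]
    omega

/-- A locally optimal coloring leaves at most two ninths of the edges uncolored. -/
theorem nine_mul_card_le (hc : G.LocalOpt c) (hG : ∀ x, G.deg x ≤ 3) (hG3 : ¬ G.HasG3) :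
    9 * (uncolored c).card ≤ 2 * Fintype.card E := by
  classical
  -- The vertex type may be infinite, so sums run over the ends of edges.
  set S : Finset V := Finset.univ.image G.fst ∪ Finset.univ.image G.snd with hSdef
  have hS : ∀ e x, G.Inc e x → x ∈ S := by
    rintro e x (rfl | rfl) <;> simp [hSdef]
  have h1 : (uncolored c).card * 18 ≤ ∑ e ∈ uncolored c, ∑ w ∈ S, G.charge c e w :=
    Finset.card_nsmul_le_sum _ _ 18 fun e he =>
      hc.le_sum_charge hG hG3 hS (mem_uncolored.1 he)
  rw [Finset.sum_comm] at h1
  have h2 := h1.trans (Finset.sum_le_sum fun w _ => hc.sum_charge_le hG w)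
  have h3 : ∑ w ∈ S, G.deg w ≤ Fintype.card E * 2 := by
    unfold deg
    simp only [Finset.card_filter]
    rw [Finset.sum_comm]
    refine Finset.sum_le_card_nsmul _ _ 2 fun e _ => ?_
    rw [← Finset.card_filter]
    refine (Finset.card_le_card (t := {G.fst e, G.snd e}) fun x hx => ?_).trans Finset.card_le_two
    have := (Finset.mem_filter.1 hx).2
    unfold Inc at this
    simp only [Finset.mem_insert, Finset.mem_singleton]
    tauto
  rw [← Finset.mul_sum] at h2
  omega

end LocalOpt

end EndMap

/-! ### Reasoning about programs and their running time -/

namespace RAM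

/-- The registers that a program writes to. -/
def Prog.regs : Prog → List ℕ
  | .skip => []
  | .const d _ => [d]
  | .add d _ _ => [d]
  | .sub d _ _ => [d]
  | .load d _ _ => [d]
  | .store _ _ _ => []
  | .seq p q => p.regs ++ q.regs
  | .cond _ p q => p.regs ++ q.regs
  | .loop _ p => p.regs

/-- The arrays that a program writes to. -/
def Prog.arrs : Prog → List ℕ
  | .store a _ _ => [a]
  | .seq p q => p.arrs ++ q.arrs
  | .cond _ p q => p.arrs ++ q.arrs
  | .loop _ p => p.arrs
  | _ => []

theorem Exec.reg_eq {p : Prog} {s s' : State} {t : ℕ} (h : Exec p s s' t) :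
    ∀ r ∉ p.regs, s'.reg r = s.reg r := by
  induction h with
  | skip | store => intro r _; rfl
  | const | add | sub | load =>
    intro r hr
    simp only [Prog.regs, List.mem_singleton] at hr
    simp [State.setReg, hr]
  | seq _ _ ih ih' =>
    intro r hr
    simp only [Prog.regs, List.mem_append, not_or] at hr
    rw [ih' r hr.2, ih r hr.1]
  | cond_true _ _ ih | cond_false _ _ ih =>
    intro r hr
    simp only [Prog.regs, List.mem_append, not_or] at hr
    simp [ih, hr]
  | loop_true _ _ _ ih ih' =>
    intro r hr
    rw [ih' r hr, ih r (by simpa [Prog.regs] using hr)]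
  | loop_false => intro r _; rfl

theorem Exec.arr_eq {p : Prog} {s s' : State} {t : ℕ} (h : Exec p s s' t) :
    ∀ a ∉ p.arrs, s'.arr a = s.arr a := by
  induction h with
  | skip | const | add | sub | load => intro r _; rfl
  | store =>
    intro r hr
    simp only [Prog.arrs, List.mem_singleton] at hr
    simp [State.setArr, hr]
  | seq _ _ ih ih' =>
    intro r hr
    simp only [Prog.arrs, List.mem_append, not_or] at hr
    rw [ih' r hr.2, ih r hr.1]
  | cond_true _ _ ih | cond_false _ _ ih =>
    intro r hr
    simp only [Prog.arrs, List.mem_append, not_or] at hr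
    simp [ih, hr]
  | loop_true _ _ _ ih ih' =>
    intro r hr
    rw [ih' r hr, ih r (by simpa [Prog.arrs] using hr)]
  | loop_false => intro r _; rfl

/-- `s` and `s'` differ at most in the registers and arrays that `p` writes to. -/
structure Frame (p : Prog) (s s' : State) : Prop where
  reg : ∀ r ∉ p.regs, s'.reg r = s.reg r
  arr : ∀ a ∉ p.arrs, s'.arr a = s.arr a

/-- Started in `s`, the program halts after at most `B` steps in a state that satisfies `Q`. -/
def Runs (p : Prog) (s : State) (B : ℕ) (Q : State → Prop) : Prop :=
  ∃ s' t, Exec p s s' t ∧ t ≤ B ∧ Q s'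

variable {p q : Prog} {s : State} {B B' : ℕ} {Q R : State → Prop}

theorem Runs.mono (h : Runs p s B Q) (hB : B ≤ B') (hQ : ∀ s', Frame p s s' → Q s' → R s') :
    Runs p s B' R :=
  let ⟨s', t, he, ht, hq⟩ := h
  ⟨s', t, he, ht.trans hB, hQ s' ⟨he.reg_eq, he.arr_eq⟩ hq⟩

theorem Runs.seq (h : Runs p s B Q) (h' : ∀ s', Frame p s s' → Q s' → Runs q s' B' R) :
    Runs (.seq p q) s (B + B') R := by
  obtain ⟨s', t, he, ht, hq⟩ := h
  obtain ⟨s'', t', he', ht', hr⟩ := h' s' ⟨he.reg_eq, he.arr_eq⟩ hq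
  exact ⟨s'', t + t', .seq he he', by omega, hr⟩

/-- Programs without loops. -/
def Prog.LoopFree : Prog → Prop
  | .seq p q => p.LoopFree ∧ q.LoopFree
  | .cond _ p q => p.LoopFree ∧ q.LoopFree
  | .loop _ _ => False
  | _ => True

open Classical in
/-- The effect of a program without loops. -/
noncomputable def Prog.eval : Prog → State → State
  | .skip, s => s
  | .const d v, s => s.setReg d v
  | .add d x y, s => s.setReg d (s.reg x + s.reg y)
  | .sub d x y, s => s.setReg d (s.reg x - s.reg y)
  | .load d a i, s => s.setReg d (s.arr a (s.reg i))
  | .store a i x, s => s.setArr a (s.reg i) (s.reg x)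
  | .seq p q, s => q.eval (p.eval s)
  | .cond b p q, s => if b.Holds s then p.eval s else q.eval s
  | .loop _ _, s => s

/-- A bound for the number of steps of a program without loops. -/
def Prog.steps : Prog → ℕ
  | .seq p q => p.steps + q.steps
  | .cond _ p q => p.steps + q.steps + 1
  | _ => 1

/-- For loop-free code the existence of an execution reduces to evaluating a function, which `simp`
can unfold. -/
theorem Runs.eval (hp : p.LoopFree) (hQ : Q (p.eval s)) : Runs p s p.steps Q := by
  suffices h : ∃ t ≤ p.steps, Exec p s (p.eval s) t from
    let ⟨t, ht, he⟩ := h; ⟨_, t, he, ht, hQ⟩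
  clear hQ
  induction p generalizing s with
  | skip => exact ⟨1, le_rfl, .skip _⟩
  | const => exact ⟨1, le_rfl, .const ..⟩
  | add => exact ⟨1, le_rfl, .add ..⟩
  | sub => exact ⟨1, le_rfl, .sub ..⟩
  | load => exact ⟨1, le_rfl, .load ..⟩
  | store => exact ⟨1, le_rfl, .store ..⟩
  | seq p q ihp ihq =>
    obtain ⟨t, ht, he⟩ := ihp (s := s) hp.1
    obtain ⟨t', ht', he'⟩ := ihq (s := p.eval s) hp.2
    exact ⟨t + t', by simp only [Prog.steps]; omega, .seq he he'⟩
  | cond b p q ihp ihq =>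
    by_cases hb : b.Holds s
    · obtain ⟨t, ht, he⟩ := ihp (s := s) hp.1
      exact ⟨t + 1, by simp only [Prog.steps]; omega, by
        simpa [Prog.eval, hb] using Exec.cond_true hb he⟩
    · obtain ⟨t, ht, he⟩ := ihq (s := s) hp.2
      exact ⟨t + 1, by simp only [Prog.steps]; omega, by
        simpa [Prog.eval, hb] using Exec.cond_false hb he⟩
  | loop => exact hp.elim

/-- A loop with an invariant and a variant. -/
theorem Runs.loop {b : Test} (Inv : State → Prop) (μ : State → ℕ) (h0 : Inv s)
    (hstep : ∀ s', Frame p s s' → Inv s' → b.Holds s' →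
      Runs p s' B (fun s'' => Inv s'' ∧ μ s'' < μ s')) :
    Runs (.loop b p) s (μ s * (B + 1) + 1) (fun s' => Inv s' ∧ ¬ b.Holds s') := by
  -- Induction on a bound `k` for the variant, which also bounds the number of remaining rounds.
  suffices h : ∀ k, ∀ s', μ s' ≤ k → Frame p s s' → Inv s' →
      Runs (.loop b p) s' (k * (B + 1) + 1) (fun s' => Inv s' ∧ ¬ b.Holds s') from
    h _ s le_rfl ⟨fun _ _ => rfl, fun _ _ => rfl⟩ h0
  intro k
  induction k with
  | zero =>
    intro s' hk hf hi
    by_cases hb : b.Holds s'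
    · obtain ⟨s'', t, -, -, -, h⟩ := hstep s' hf hi hb
      omega
    · exact ⟨s', 1, .loop_false hb, by omega, hi, hb⟩
  | succ k ih =>
    intro s' hk hf hi
    by_cases hb : b.Holds s'
    · obtain ⟨s'', t, he, ht, hi', hlt⟩ := hstep s' hf hi hb
      obtain ⟨s₃, t', he', ht', hq⟩ := ih s'' (by omega)
        ⟨fun r hr => (he.reg_eq r hr).trans (hf.reg r hr),
          fun a ha => (he.arr_eq a ha).trans (hf.arr a ha)⟩ hi'
      exact ⟨s₃, t + 1 + t', .loop_true hb he he', by
        have : (k + 1) * (B + 1) = k * (B + 1) + (B + 1) := by ring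
        omega, hq⟩
    · exact ⟨s', 1, .loop_false hb, by omega, hi, hb⟩

/-- `p` is repeated with the register `x` running from `0` to the content of the register `y`. The
register `3` has to contain the number `1`. -/
def Prog.for (x y : ℕ) (p : Prog) : Prog :=
  .seq (.const x 0) (.loop (.lt x y) (.seq p (.add x x 3)))

/-- Conditions on the registers of a counting loop. -/
def ForOk (x y : ℕ) (p : Prog) : Prop :=
  x ∉ p.regs ∧ y ∉ p.regs ∧ 3 ∉ p.regs ∧ x ≠ y ∧ x ≠ 3

instance (x y : ℕ) (p : Prog) : Decidable (ForOk x y p) := by unfold ForOk; infer_instance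

/-- The increment and the test are charged here: a round costs `B + 2`. Therefore the invariant is
demanded of the state in which the counter has already advanced. -/
theorem Runs.for {x y N : ℕ} (hok : ForOk x y p) (hN : s.reg y = N) (h1 : s.reg 3 = 1)
    (Inv : ℕ → State → Prop) (h0 : Inv 0 (s.setReg x 0))
    (hstep : ∀ k < N, ∀ s', (∀ r ∉ p.regs, r ≠ x → s'.reg r = s.reg r) →
      (∀ a ∉ p.arrs, s'.arr a = s.arr a) → s'.reg x = k → Inv k s' →
      Runs p s' B (fun s'' => Inv (k + 1) (s''.setReg x (k + 1)))) :
    Runs (.for x y p) s (N * (B + 2) + 2) (fun s' => Inv N s' ∧ s'.reg x = N) := by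
  obtain ⟨hx, hy, h3, hxy, hx3⟩ := hok
  have hloop := Runs.loop (b := .lt x y) (p := .seq p (.add x x 3)) (s := s.setReg x 0) (B := B + 1)
    (fun s' => s'.reg x ≤ N ∧ Inv (s'.reg x) s') (fun s' => N - s'.reg x)
    ⟨by simp [State.setReg], by simpa [State.setReg] using h0⟩ (by
      intro s' hf ⟨hle, hi⟩ hb
      have hr : ∀ r ∉ p.regs, r ≠ x → s'.reg r = s.reg r := by
        intro r hr hrx
        rw [hf.reg r (by simp [Prog.regs, hr, hrx])]
        simp [State.setReg, hrx]
      have hb' : s'.reg x < s'.reg y := hb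
      rw [hr y hy hxy.symm, hN] at hb'
      refine (hstep _ hb' s' hr (fun a ha => ?_) rfl hi).seq fun s₂ hf₂ h2 => ?_
      · rw [hf.arr a (by simp [Prog.arrs, ha])]; rfl
      · have hs : s₂.reg x + s₂.reg 3 = s'.reg x + 1 := by
          rw [hf₂.reg x hx, hf₂.reg 3 h3, hr 3 h3 hx3.symm, h1]
        refine ⟨_, 1, .add _ _ _ _, le_rfl, ?_⟩
        rw [hs]
        refine ⟨⟨?_, ?_⟩, ?_⟩
        · simpa [State.setReg] using hb'
        · simpa [State.setReg] using h2
        · simp [State.setReg]; omega)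
  obtain ⟨s', t, he, ht, ⟨hle, hi⟩, hb⟩ := hloop
  refine ⟨s', 1 + t, .seq (.const _ _ _) he, ?_, ?_⟩
  · simp only [State.setReg, Function.update_self, Nat.sub_zero] at ht
    linarith
  · have : s'.reg y = N := by
      rw [he.reg_eq y (by simp [Prog.regs, hy, hxy.symm])]
      simpa [State.setReg, hxy.symm] using hN
    have hb' : ¬ s'.reg x < s'.reg y := hb
    have : s'.reg x = N := by omega
    exact ⟨this ▸ hi, this⟩

end RAM

/-! ### Subroutines: copying, forcing, exchanging, computing the cost -/

namespace RAM

/-- The constants of the main program and its copy of the multigraph, with the degrees. -/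
structure Ctx {m : ℕ} (n : ℕ) (G : EndMap ℕ (Fin m)) (s : State) : Prop where
  reg0 : s.reg 0 = n
  reg1 : s.reg 1 = m
  reg2 : s.reg 2 = 3
  reg3 : s.reg 3 = 1
  reg4 : s.reg 4 = 0
  reg5 : s.reg 5 = 6 * m + 1
  arr0 : ∀ e : Fin m, s.arr 0 e = G.fst e
  arr1 : ∀ e : Fin m, s.arr 1 e = G.snd e
  arr5 : ∀ x < n, s.arr 5 x = G.deg x
  lt : ∀ e : Fin m, G.fst e < n ∧ G.snd e < n

/-- The part of an array that is indexed by the edges. -/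
def State.col (s : State) (m a : ℕ) : Fin m → ℕ := fun e => s.arr a e

/-- The program leaves the context alone. -/
def Prog.Keeps (p : Prog) : Prop :=
  (∀ r ∈ [0, 1, 2, 3, 4, 5], r ∉ p.regs) ∧ ∀ a ∈ [0, 1, 5], a ∉ p.arrs

instance (p : Prog) : Decidable p.Keeps := by unfold Prog.Keeps; infer_instance

variable {m n : ℕ} {G : EndMap ℕ (Fin m)} {s : State}

theorem Ctx.of_eq (h : Ctx n G s) {s' : State} (hr : ∀ r ∈ [0, 1, 2, 3, 4, 5], s'.reg r = s.reg r)
    (ha : ∀ a ∈ [0, 1, 5], s'.arr a = s.arr a) : Ctx n G s' := by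
  simp only [List.mem_cons, List.not_mem_nil, or_false, forall_eq_or_imp, forall_eq] at hr ha
  obtain ⟨h0, h1, h2, h3, h4, h5⟩ := hr
  obtain ⟨a0, a1, a5⟩ := ha
  constructor
  · rw [h0, h.reg0]
  · rw [h1, h.reg1]
  · rw [h2, h.reg2]
  · rw [h3, h.reg3]
  · rw [h4, h.reg4]
  · rw [h5, h.reg5]
  · rw [a0]; exact h.arr0
  · rw [a1]; exact h.arr1
  · rw [a5]; exact h.arr5
  · exact h.lt

theorem Ctx.frame (h : Ctx n G s) {p : Prog} {s' : State} (hp : p.Keeps) (hf : Frame p s s') :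
    Ctx n G s' :=
  h.of_eq (fun r hr => hf.reg r (hp.1 r hr)) (fun a ha => hf.arr a (hp.2 a ha))

theorem Ctx.frame' (h : Ctx n G s) {p : Prog} {s' : State} {x : ℕ} (hp : p.Keeps) (hx : 5 < x)
    (hr : ∀ r ∉ p.regs, r ≠ x → s'.reg r = s.reg r) (ha : ∀ a ∉ p.arrs, s'.arr a = s.arr a) :
    Ctx n G s' :=
  h.of_eq (fun r h => hr r (hp.1 r h) (by simp at h; omega)) (fun a h => ha a (hp.2 a h))

theorem Ctx.fst (h : Ctx n G s) {k : ℕ} (hk : k < m) : s.arr 0 k = G.fst ⟨k, hk⟩ := h.arr0 ⟨k, hk⟩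

theorem Ctx.snd (h : Ctx n G s) {k : ℕ} (hk : k < m) : s.arr 1 k = G.snd ⟨k, hk⟩ := h.arr1 ⟨k, hk⟩

/-- Copy the cell of the array `a` in the register `20` to the array `b`. -/
def copyBody (a b : ℕ) : Prog := .seq (.load 21 a 20) (.store b 20 21)

/-- Copy the coloring in the array `a` to the array `b`. -/
def copy (a b : ℕ) : Prog := .for 20 1 (copyBody a b)

theorem runs_copy (hs : Ctx n G s) {a b : ℕ} (hab : a ≠ b) :
    Runs (copy a b) s (m * 4 + 2) (fun s' => s'.col m b = s.col m a) := by
  refine Runs.mono (Runs.for (N := m) (B := 2) (p := copyBody a b) ?_ hs.reg1 hs.reg3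
    (fun k s' => ∀ e : Fin m, (e : ℕ) < k → s'.arr b e = s.arr a e) (by simp) ?_) le_rfl ?_
  · simp [ForOk, copyBody, Prog.regs]
  · intro k hk s' hr ha hx hi
    have := ha a (by simpa [copyBody, Prog.arrs] using hab)
    refine Runs.eval ⟨trivial, trivial⟩ ?_
    intro e he
    simp only [copyBody, Prog.eval, State.setReg, State.setArr, Function.update_self, hx, this,
      Function.update_apply]
    simp only [show (20 : ℕ) ≠ 21 by decide, if_false]
    split_ifs with h
    · rw [h]
    · exact hi e (by omega)
  · rintro s' - ⟨h, -⟩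
    funext e
    exact h e e.2

/-- Uncolor the edge in the register `20` if it has the color in the register `40` and touches an
edge with the ends in the registers `37` and `38`. -/
def forceBody : Prog :=
  .seq (.load 21 3 20) <| .cond (.eq 21 40)
    (.seq (.load 22 0 20) <| .seq (.load 23 1 20) <|
      .cond (.eq 22 37) (.store 3 20 4) <| .cond (.eq 22 38) (.store 3 20 4) <|
      .cond (.eq 23 37) (.store 3 20 4) <| .cond (.eq 23 38) (.store 3 20 4) .skip)
    .skip

open Classical in
theorem forceBody_arr (h4 : s.reg 4 = 0) :
    (forceBody.eval s).arr 3 = if s.arr 3 (s.reg 20) = s.reg 40 ∧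
      ((s.arr 0 (s.reg 20) = s.reg 37 ∨ s.arr 1 (s.reg 20) = s.reg 37) ∨
        (s.arr 0 (s.reg 20) = s.reg 38 ∨ s.arr 1 (s.reg 20) = s.reg 38)) then
      Function.update (s.arr 3) (s.reg 20) 0 else s.arr 3 := by
  by_cases h1 : s.arr 3 (s.reg 20) = s.reg 40
  · by_cases h2 : s.arr 0 (s.reg 20) = s.reg 37
    · simp [forceBody, Prog.eval, State.setReg, State.setArr, Test.Holds, h1, h2, h4]
    by_cases h3 : s.arr 0 (s.reg 20) = s.reg 38
    · simp [forceBody, Prog.eval, State.setReg, State.setArr, Test.Holds, h1, h3, h4]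
    by_cases h5 : s.arr 1 (s.reg 20) = s.reg 37
    · simp [forceBody, Prog.eval, State.setReg, State.setArr, Test.Holds, h1, h2, h3, h4, h5]
    by_cases h6 : s.arr 1 (s.reg 20) = s.reg 38
    · simp [forceBody, Prog.eval, State.setReg, State.setArr, Test.Holds, h1, h2, h3, h4, h6]
    · simp [forceBody, Prog.eval, State.setReg, Test.Holds, h1, h2, h3, h5, h6]
  · simp [forceBody, Prog.eval, State.setReg, Test.Holds, h1]

/-- Force the color in the register `40` on the edge in the register `39`. -/
def forceProg : Prog :=
  .seq (.seq (.load 37 0 39) (.load 38 1 39)) <| .seq (.for 20 1 forceBody) (.store 3 39 40)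

open Classical in
-- The scan may also uncolor `t` itself, since `t` touches its own ends; this is harmless, because
-- the color of `t` is stored last.
theorem runs_forceProg (hs : Ctx n G s) {t : Fin m} (ht : s.reg 39 = t) :
    Runs forceProg s (m * 16 + 5) (fun s' => s'.col m 3 = G.force (s.col m 3) t (s.reg 40)) := by
  refine Runs.mono (B := 2 + ((m * (14 + 2) + 2) + 1)) (Runs.seq (Runs.eval (Q := fun s' =>
    s'.reg 37 = G.fst t ∧ s'.reg 38 = G.snd t) ⟨trivial, trivial⟩ ?_) fun s₁ hf₁ h₁ => Runs.seq
    (Runs.for (N := m) (B := 14) (p := forceBody) (by decide)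
      (hs.frame (by decide) hf₁).reg1 (hs.frame (by decide) hf₁).reg3
      (fun k s' => ∀ e : Fin m, s'.arr 3 e = if (e : ℕ) < k ∧ s.arr 3 e = s.reg 40 ∧
        (G.Inc e (G.fst t) ∨ G.Inc e (G.snd t)) then 0 else s.arr 3 e) ?_ ?_)
    fun s₂ hf₂ h₂ => ?_) (by omega) (R := fun s' => s'.col m 3 = G.force (s.col m 3) t (s.reg 40))
    fun s' _ h => h
  · simp [Prog.eval, State.setReg, ht, hs.arr0, hs.arr1]
  · intro e
    simp only [not_lt_zero, false_and, if_false]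
    exact congrFun (hf₁.arr 3 (by decide)) e
  · intro k hk s' hr ha hx hi
    have hc := (hs.frame (by decide) hf₁).frame' (x := 20) (p := forceBody) (by decide) (by decide)
      hr ha
    have h37 : s'.reg 37 = G.fst t := (hr 37 (by decide) (by decide)).trans h₁.1
    have h38 : s'.reg 38 = G.snd t := (hr 38 (by decide) (by decide)).trans h₁.2
    have h40 : s'.reg 40 = s.reg 40 :=
      (hr 40 (by decide) (by decide)).trans (hf₁.reg 40 (by decide))
    refine Runs.eval (p := forceBody) (by simp [forceBody, Prog.LoopFree]) ?_
    have hk3 := hi ⟨k, hk⟩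
    simp only [lt_self_iff_false, false_and, if_false] at hk3
    intro e
    change (forceBody.eval s').arr 3 e = _
    rw [forceBody_arr hc.reg4, hx, hk3, h37, h38, h40, hc.fst hk, hc.snd hk]
    by_cases hek : (e : ℕ) = k
    · obtain rfl : e = ⟨k, hk⟩ := Fin.ext hek
      simp only [EndMap.Inc, Nat.lt_succ_self, true_and]
      split_ifs <;> simp [hk3]
    · simp only [show ((e : ℕ) < k + 1 ↔ (e : ℕ) < k) by omega]
      rw [← hi e]
      split_ifs <;> simp [hek]
  · refine Runs.eval (p := .store 3 39 40) trivial ?_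
    have hf₁39 : s₂.reg 39 = t :=
      ((hf₂.reg 39 (by decide)).trans (hf₁.reg 39 (by decide))).trans ht
    have h40 : s₂.reg 40 = s.reg 40 := (hf₂.reg 40 (by decide)).trans (hf₁.reg 40 (by decide))
    funext e
    simp only [State.col, Prog.eval, State.setArr, Function.update_self, hf₁39, h40, EndMap.force]
    by_cases he : e = t
    · simp [he]
    · rw [Function.update_of_ne (fun h => he (Fin.ext h)), if_neg he, h₂.1 e]
      simp only [e.2, true_and]
      congr

/-- Exchange the colors in the registers `30` and `31` on the edge in the register `20` if its first
end is marked. -/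
def swapBody : Prog :=
  .seq (.load 21 3 20) <| .seq (.load 22 0 20) <| .seq (.load 23 4 22) <|
    .cond (.eq 23 4) .skip <| .cond (.eq 21 30) (.store 3 20 31) <|
    .cond (.eq 21 31) (.store 3 20 30) .skip

open Classical in
theorem swapBody_arr : (swapBody.eval s).arr 3 = if s.arr 4 (s.arr 0 (s.reg 20)) = s.reg 4 then
      s.arr 3 else Function.update (s.arr 3) (s.reg 20)
        (Equiv.swap (s.reg 30) (s.reg 31) (s.arr 3 (s.reg 20))) := by
  by_cases h1 : s.arr 4 (s.arr 0 (s.reg 20)) = s.reg 4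
  · simp [swapBody, Prog.eval, State.setReg, Test.Holds, h1]
  by_cases h2 : s.arr 3 (s.reg 20) = s.reg 30
  · simp [swapBody, Prog.eval, State.setReg, State.setArr, Test.Holds, h1, h2]
  by_cases h3 : s.arr 3 (s.reg 20) = s.reg 31
  · simp [swapBody, Prog.eval, State.setReg, State.setArr, Test.Holds, h1, h3]
    rw [if_neg (h3 ▸ h2)]
    simp
  · simp [swapBody, Prog.eval, State.setReg, Test.Holds, h1, h2, h3,
      Equiv.swap_apply_of_ne_of_ne h2 h3]

open Classical in
theorem runs_swap (hs : Ctx n G s) (K : ℕ → Prop)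
    (hK : ∀ e : Fin m, s.arr 4 (G.fst e) = 0 ↔ ¬ K (G.fst e)) :
    Runs (.for 20 1 swapBody) s (m * 12 + 2)
      (fun s' => s'.col m 3 = G.swapOn (s.col m 3) K (s.reg 30) (s.reg 31)) := by
  refine Runs.mono (Runs.for (N := m) (B := 10) (p := swapBody) (by decide) hs.reg1 hs.reg3
    (fun k s' => ∀ e : Fin m, s'.arr 3 e = if (e : ℕ) < k ∧ K (G.fst e) then
      Equiv.swap (s.reg 30) (s.reg 31) (s.arr 3 e) else s.arr 3 e) (by simp [State.setReg]) ?_)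
    le_rfl ?_
  · intro k hk s' hr ha hx hi
    have hc := hs.frame' (x := 20) (p := swapBody) (by decide) (by decide) hr ha
    have h30 := hr 30 (by decide) (by decide)
    have h31 := hr 31 (by decide) (by decide)
    have h4 := ha 4 (by decide)
    refine Runs.eval (p := swapBody) (by simp [swapBody, Prog.LoopFree]) ?_
    have hk3 := hi ⟨k, hk⟩
    simp only [lt_self_iff_false, false_and, if_false] at hk3
    intro e
    change (swapBody.eval s').arr 3 e = _
    rw [swapBody_arr, hx, hk3, h30, h31, h4, hc.reg4, hc.fst hk]
    simp only [hK]
    by_cases hek : (e : ℕ) = k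
    · obtain rfl : e = ⟨k, hk⟩ := Fin.ext hek
      simp only [Nat.lt_succ_self, true_and]
      split_ifs <;> simp_all
    · simp only [show ((e : ℕ) < k + 1 ↔ (e : ℕ) < k) by omega]
      rw [← hi e]
      split_ifs <;> simp [hek]
  · rintro s' - ⟨h, -⟩
    funext e
    simp [State.col, h e, EndMap.swapOn]

/-- Add the cost of the edge in the register `20` to the register `d` if it is uncolored. -/
def costBody (a d : ℕ) : Prog :=
  .seq (.load 21 a 20) <| .cond (.eq 21 4)
    (.seq (.load 22 0 20) <| .seq (.load 23 1 20) <| .seq (.load 24 5 22) <|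
      .seq (.load 25 5 23) <| .seq (.add d d 5) <| .seq (.add d d 24) (.add d d 25)) .skip

theorem costBody_reg {a d : ℕ} (hd : 25 < d) : ((costBody a d).eval s).reg d =
    if s.arr a (s.reg 20) = s.reg 4 then s.reg d + s.reg 5 + s.arr 5 (s.arr 0 (s.reg 20)) +
      s.arr 5 (s.arr 1 (s.reg 20)) else s.reg d := by
  have h : ∀ r ≤ 25, r ≠ d ∧ d ≠ r := by intros; omega
  have h0 := h 20 (by simp)
  have h1 := h 21 (by simp)
  have h2 := h 22 (by simp)
  have h3 := h 23 (by simp)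
  have h4 := h 24 (by simp)
  have h5 := h 25 (by simp)
  have h6 := h 5 (by simp)
  by_cases h7 : s.arr a (s.reg 20) = s.reg 4
  · simp [costBody, Prog.eval, State.setReg, Test.Holds, *]
  · simp [costBody, Prog.eval, State.setReg, Test.Holds, *]

/-- Compute the cost of the coloring in the array `a`. -/
def costProg (a d : ℕ) : Prog := .seq (.const d 0) (.for 20 1 (costBody a d))

theorem runs_cost (hs : Ctx n G s) {a d : ℕ} (hd : 25 < d) :
    Runs (costProg a d) s (m * 12 + 3) (fun s' => s'.reg d = G.cost (s.col m a)) := by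
  classical
  -- The summand is extended by zero to all of `ℕ`, so that the loop invariant is a sum over an
  -- initial segment.
  set F : ℕ → ℕ := fun k => if h : k < m then (if s.arr a k = 0 then
    6 * m + 1 + (G.deg (G.fst ⟨k, h⟩) + G.deg (G.snd ⟨k, h⟩)) else 0) else 0 with hF
  have hregs : ∀ r, r ≤ 20 → r ∉ (costBody a d).regs := by
    intro r hr
    simp [costBody, Prog.regs]
    omega
  have harrs : (costBody a d).arrs = [] := rfl
  have hkeep : (costBody a d).Keeps :=
    ⟨fun r hr => hregs r (by simp at hr; omega), fun _ _ => by simp [harrs]⟩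
  have hs' : Ctx n G (s.setReg d 0) := hs.of_eq (fun r hr => by
    simp at hr
    simp only [State.setReg]
    rw [Function.update_of_ne (by omega)]) (fun _ _ => rfl)
  have hfor := Runs.for (s := s.setReg d 0) (N := m) (B := 10) (p := costBody a d)
    ⟨hregs _ le_rfl, hregs _ (by simp), hregs _ (by simp), by simp, by simp⟩ hs'.reg1 hs'.reg3
    (fun k s' => s'.reg d = ∑ i ∈ Finset.range k, F i) ?_ ?_
  · obtain ⟨s', t, he, ht, h, -⟩ := hfor
    refine ⟨s', 1 + t, .seq (.const _ _ _) he, by omega, ?_⟩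
    beta_reduce
    rw [h, Finset.sum_range, EndMap.cost, EndMap.uncolored, Finset.sum_filter]
    refine Finset.sum_congr rfl fun e _ => ?_
    simp [hF, State.col]
  · simp only [State.setReg, Finset.range_zero, Finset.sum_empty]
    rw [Function.update_of_ne (by omega), Function.update_self]
  · intro k hk s' hr ha hx hi
    have hc := hs'.frame' (x := 20) (p := costBody a d) hkeep (by decide) hr ha
    refine Runs.eval (p := costBody a d) (by simp [costBody, Prog.LoopFree]) ?_
    have h1 : s'.arr a = s.arr a := ha a (by simp [harrs])
    have h5 : s'.reg 5 = 6 * m + 1 := hc.reg5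
    have h2 := hc.arr5 _ (hc.lt ⟨k, hk⟩).1
    have h3 := hc.arr5 _ (hc.lt ⟨k, hk⟩).2
    rw [Finset.sum_range_succ, ← hi]
    have h6 : (((costBody a d).eval s').setReg 20 (k + 1)).reg d = ((costBody a d).eval s').reg d :=
      Function.update_of_ne (by omega) _ _
    rw [h6, costBody_reg hd, hx, hc.reg4, hc.fst hk, hc.snd hk, h1, h2, h3, h5]
    simp only [hF, hk, dif_pos]
    split_ifs <;> omega

end RAM

/-! ### Marking a Kempe component -/

namespace RAM

variable {m n : ℕ} {G : EndMap ℕ (Fin m)} {s : State}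

/-- Mark the ends of the edge in the register `20` if one of them is marked. -/
def markEdge : Prog :=
  .seq (.load 22 0 20) <| .seq (.load 23 1 20) <| .seq (.load 24 4 22) <| .seq (.load 25 4 23) <|
    .cond (.eq 24 25) .skip (.seq (.store 4 22 3) <| .seq (.store 4 23 3) <| .const 34 1)

/-- The same for the edges with one of the colors in the registers `30` and `31`. -/
def markBody : Prog :=
  .seq (.load 21 3 20) <| .cond (.eq 21 30) markEdge (.cond (.eq 21 31) markEdge .skip)

theorem markBody_of_not (h : (s.arr 3 (s.reg 20) = s.reg 30 ∨ s.arr 3 (s.reg 20) = s.reg 31) →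
      s.arr 4 (s.arr 0 (s.reg 20)) = s.arr 4 (s.arr 1 (s.reg 20))) :
    (markBody.eval s).arr 4 = s.arr 4 ∧ (markBody.eval s).reg 34 = s.reg 34 := by
  by_cases h1 : s.arr 3 (s.reg 20) = s.reg 30
  · simp [markBody, markEdge, Prog.eval, State.setReg, Test.Holds, h1, h (.inl h1)]
  by_cases h2 : s.arr 3 (s.reg 20) = s.reg 31
  · by_cases h3 : s.reg 31 = s.reg 30
    · exact absurd (h2.trans h3) h1
    · simp [markBody, markEdge, Prog.eval, State.setReg, Test.Holds, h2, h3, h (.inr h2)]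
  · simp [markBody, Prog.eval, State.setReg, Test.Holds, h1, h2]

theorem markBody_of (h1 : s.reg 3 = 1)
    (h : s.arr 3 (s.reg 20) = s.reg 30 ∨ s.arr 3 (s.reg 20) = s.reg 31)
    (hne : s.arr 4 (s.arr 0 (s.reg 20)) ≠ s.arr 4 (s.arr 1 (s.reg 20))) :
    (markBody.eval s).arr 4 = Function.update (Function.update (s.arr 4) (s.arr 0 (s.reg 20)) 1)
      (s.arr 1 (s.reg 20)) 1 ∧ (markBody.eval s).reg 34 = 1 := by
  by_cases h2 : s.arr 3 (s.reg 20) = s.reg 30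
  · simp [markBody, markEdge, Prog.eval, State.setReg, State.setArr, Test.Holds, h2, hne, h1]
  · have h3 := h.resolve_left h2
    have h4 : s.reg 31 ≠ s.reg 30 := h3 ▸ h2
    simp [markBody, markEdge, Prog.eval, State.setReg, State.setArr, Test.Holds, h3, h4, hne, h1]

/-- The number of unmarked vertices. -/
def unmarked (n : ℕ) (M : ℕ → ℕ) : ℕ := ((Finset.range n).filter fun y => M y = 0).card

theorem unmarked_update_lt {M : ℕ → ℕ} {a b : ℕ} (ha : a < n) (hb : b < n)
    (h : M a = 0 ∨ M b = 0) :
    unmarked n (Function.update (Function.update M a 1) b 1) < unmarked n M := by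
  refine Finset.card_lt_card ⟨fun y hy => ?_, fun hsub => ?_⟩
  · simp only [Finset.mem_filter, Finset.mem_range, Function.update_apply] at hy ⊢
    refine ⟨hy.1, ?_⟩
    have := hy.2
    split_ifs at this
    exact this
  · rcases h with h | h
    · have := hsub (Finset.mem_filter.2 ⟨Finset.mem_range.2 ha, h⟩)
      simp [Function.update_apply] at this
    · have := hsub (Finset.mem_filter.2 ⟨Finset.mem_range.2 hb, h⟩)
      simp at this

/-- The marks are zeros and ones, and only vertices in the Kempe component of `x` are marked. -/
structure Marked (n : ℕ) (K : ℕ → Prop) (x : ℕ) (M : ℕ → ℕ) : Prop where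
  le_one : ∀ y < n, M y ≤ 1
  sound : ∀ y < n, M y ≠ 0 → K y
  start : M x = 1

/-- One round of the marking. -/
theorem runs_markRound (hs : Ctx n G s) {x : ℕ}
    (hM : Marked n (G.Reach (s.col m 3) (s.reg 30) (s.reg 31) x) x (s.arr 4)) (h0 : s.reg 34 = 0) :
    Runs (.for 20 1 markBody) s (m * 24 + 2) (fun s' =>
      Marked n (G.Reach (s.col m 3) (s.reg 30) (s.reg 31) x) x (s'.arr 4) ∧
      ((s'.reg 34 = 0 ∧ s'.arr 4 = s.arr 4 ∧ ∀ e : Fin m, (s.arr 3 e = s.reg 30 ∨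
        s.arr 3 e = s.reg 31) → s.arr 4 (G.fst e) = s.arr 4 (G.snd e)) ∨
      (s'.reg 34 = 1 ∧ unmarked n (s'.arr 4) < unmarked n (s.arr 4)))) := by
  refine Runs.mono (Runs.for (N := m) (B := 22) (p := markBody) (by decide) hs.reg1 hs.reg3
    (fun k s' => Marked n (G.Reach (s.col m 3) (s.reg 30) (s.reg 31) x) x (s'.arr 4) ∧
      ((s'.reg 34 = 0 ∧ s'.arr 4 = s.arr 4 ∧ ∀ e : Fin m, (e : ℕ) < k → (s.arr 3 e = s.reg 30 ∨
        s.arr 3 e = s.reg 31) → s.arr 4 (G.fst e) = s.arr 4 (G.snd e)) ∨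
      (s'.reg 34 = 1 ∧ unmarked n (s'.arr 4) < unmarked n (s.arr 4)))) ?_ ?_) le_rfl ?_
  · exact ⟨hM, .inl ⟨h0, rfl, by simp⟩⟩
  · intro k hk s' hr ha hx ⟨hM', hi⟩
    have h3 := ha 3 (by decide)
    have hr3 : s'.reg 3 = 1 := (hr 3 (by decide) (by decide)).trans hs.reg3
    have h30 := hr 30 (by decide) (by decide)
    have h31 := hr 31 (by decide) (by decide)
    have hA : s'.arr 0 k = G.fst ⟨k, hk⟩ := (congrFun (ha 0 (by decide)) k).trans (hs.fst hk)
    have hB : s'.arr 1 k = G.snd ⟨k, hk⟩ := (congrFun (ha 1 (by decide)) k).trans (hs.snd hk)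
    obtain ⟨hlta, hltb⟩ := hs.lt ⟨k, hk⟩
    refine Runs.mono (Runs.eval (p := markBody) (s := s')
      (by simp [markBody, markEdge, Prog.LoopFree]) (Q := fun s'' => s'' = markBody.eval s') rfl)
      (by decide) ?_
    rintro _ - rfl
    change Marked n _ x ((markBody.eval s').arr 4) ∧ (((markBody.eval s').reg 34 = 0 ∧
      (markBody.eval s').arr 4 = _ ∧ _) ∨ ((markBody.eval s').reg 34 = 1 ∧
      unmarked n ((markBody.eval s').arr 4) < _))
    by_cases hcol : s.arr 3 k = s.reg 30 ∨ s.arr 3 k = s.reg 31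
    · by_cases hne : s'.arr 4 (G.fst ⟨k, hk⟩) = s'.arr 4 (G.snd ⟨k, hk⟩)
      · obtain ⟨h1, h2⟩ := markBody_of_not (s := s') (by rw [hx, hA, hB]; exact fun _ => hne)
        rw [h1, h2]
        refine ⟨hM', hi.imp_left fun ⟨h4, h5, h6⟩ => ⟨h4, h5, fun e he hce => ?_⟩⟩
        rcases Nat.lt_succ_iff_lt_or_eq.1 he with he | he
        · exact h6 e he hce
        · obtain rfl : e = ⟨k, hk⟩ := Fin.ext he
          rw [← h5]; exact hne
      · obtain ⟨h1, h2⟩ := markBody_of (s := s') hr3 (by rw [hx, h3, h30, h31]; exact hcol)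
          (by rw [hx, hA, hB]; exact hne)
        rw [hx, hA, hB] at h1
        rw [h1, h2]
        have hle := hM'.le_one _ hlta
        have hle' := hM'.le_one _ hltb
        have hstep : G.Step (s.col m 3) (s.reg 30) (s.reg 31) (G.fst ⟨k, hk⟩) (G.snd ⟨k, hk⟩) :=
          ⟨⟨k, hk⟩, EndMap.link_ends _, hcol⟩
        have hK : G.Reach (s.col m 3) (s.reg 30) (s.reg 31) x (G.fst ⟨k, hk⟩) ∧
            G.Reach (s.col m 3) (s.reg 30) (s.reg 31) x (G.snd ⟨k, hk⟩) := by
          -- The marks are zeros and ones and differ, so exactly one end is marked; it belongs to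
          -- the component and brings the other end in.
          have h4 := EndMap.step_reach_iff (x := x) hstep
          by_cases h5 : s'.arr 4 (G.fst ⟨k, hk⟩) = 0
          · have := hM'.sound _ hltb (by omega)
            exact ⟨h4.2 this, this⟩
          · have := hM'.sound _ hlta h5
            exact ⟨this, h4.1 this⟩
        have hlt := unmarked_update_lt (M := s'.arr 4) hlta hltb (by omega)
        refine ⟨⟨fun y hy => ?_, fun y hy => ?_, ?_⟩, .inr ⟨rfl, hlt.trans_le ?_⟩⟩
        · have := hM'.le_one y hy
          simp only [Function.update_apply]
          split_ifs <;> omega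
        · have := hM'.sound y hy
          simp only [Function.update_apply]
          split_ifs with h5 h6
          · subst h5; exact fun _ => hK.2
          · subst h6; exact fun _ => hK.1
          · exact this
        · have := hM'.start
          simp only [Function.update_apply]
          split_ifs <;> omega
        · rcases hi with ⟨-, h, -⟩ | ⟨-, h⟩
          · rw [h]
          · exact h.le
    · obtain ⟨h1, h2⟩ := markBody_of_not (s := s') (by
        rw [hx, h3, h30, h31]; exact fun h => absurd h hcol)
      rw [h1, h2]
      refine ⟨hM', hi.imp_left fun ⟨h4, h5, h6⟩ => ⟨h4, h5, fun e he hce => ?_⟩⟩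
      rcases Nat.lt_succ_iff_lt_or_eq.1 he with he | he
      · exact h6 e he hce
      · rw [he] at hce; exact absurd hce hcol
  · rintro s' - ⟨⟨h1, h2⟩, -⟩
    exact ⟨h1, h2.imp_left fun ⟨h3, h4, h5⟩ => ⟨h3, h4, fun e => h5 e e.2⟩⟩

/-- Mark the Kempe component of the vertex in the register `11` for the colors in the registers
`30` and `31`. -/
def markProg : Prog :=
  .seq (.for 20 0 (.store 4 20 4)) <| .seq (.seq (.store 4 11 3) (.const 34 1)) <|
    .loop (.lt 4 34) (.seq (.const 34 0) (.for 20 1 markBody))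

theorem runs_mark (hs : Ctx n G s) :
    Runs markProg s (n * 3 + 2 + (2 + ((n + 1) * (m * 24 + 4) + 1))) (fun s' =>
      ∀ y < n, s'.arr 4 y = 0 ↔ ¬ G.Reach (s.col m 3) (s.reg 30) (s.reg 31) (s.reg 11) y) := by
  refine Runs.seq (Runs.for (N := n) (B := 1) (p := .store 4 20 4) (by decide) hs.reg0 hs.reg3
    (fun k s1 => ∀ y < k, s1.arr 4 y = 0) (by simp) ?_) fun s₁ hf₁ h₁ =>
    Runs.seq (Runs.eval (p := .seq (.store 4 11 3) (.const 34 1)) (Q := fun s' =>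
      s'.arr 4 = Function.update (s₁.arr 4) (s.reg 11) 1 ∧ s'.reg 34 = 1) ⟨trivial, trivial⟩ ?_)
    fun s₂ hf₂ hm => ?_
  · intro k hk s' hr ha hq hi
    have h4 : s'.reg 4 = 0 := (hr 4 (by decide) (by decide)).trans hs.reg4
    refine Runs.eval trivial fun y hy => ?_
    simp only [Prog.eval, State.setReg, State.setArr, Function.update_self, hq, h4,
      Function.update_apply]
    split_ifs with h
    · rfl
    · exact hi y (by omega)
  · have h11 : s₁.reg 11 = s.reg 11 := hf₁.reg 11 (by decide)
    have h3 : s₁.reg 3 = 1 := (hf₁.reg 3 (by decide)).trans hs.reg3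
    simp [Prog.eval, State.setReg, State.setArr, h11, h3]
  · obtain ⟨h₁, -⟩ := h₁
    obtain ⟨h₂, h₂'⟩ := hm
    have hs₂ : Ctx n G s₂ := (hs.frame (by decide) hf₁).frame (by decide) hf₂
    have h30 : s₂.reg 30 = s.reg 30 := (hf₂.reg 30 (by decide)).trans (hf₁.reg 30 (by decide))
    have h31 : s₂.reg 31 = s.reg 31 := (hf₂.reg 31 (by decide)).trans (hf₁.reg 31 (by decide))
    have h3 : s₂.arr 3 = s.arr 3 := (hf₂.arr 3 (by decide)).trans (hf₁.arr 3 (by decide))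
    set K := G.Reach (s.col m 3) (s.reg 30) (s.reg 31) (s.reg 11) with hK
    have hmarked : Marked n K (s.reg 11) (s₂.arr 4) := by
      rw [h₂]
      refine ⟨fun y hy => ?_, fun y hy => ?_, by simp⟩
      · simp only [Function.update_apply, h₁ y hy]
        split_ifs <;> simp
      · simp only [Function.update_apply, h₁ y hy]
        split_ifs with h
        · subst h; exact fun _ => Relation.ReflTransGen.refl
        · exact fun h => absurd rfl h
    refine Runs.mono (Runs.loop (B := 1 + (m * 24 + 2))
      (fun s' => Marked n K (s.reg 11) (s'.arr 4) ∧ (s'.reg 34 = 1 ∨ s'.reg 34 = 0 ∧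
        ∀ e : Fin m, (s.arr 3 e = s.reg 30 ∨ s.arr 3 e = s.reg 31) →
          s'.arr 4 (G.fst e) = s'.arr 4 (G.snd e)))
      -- A round either marks a new vertex and ends with the flag 1, or marks nothing and clears the
      -- flag. So the sum drops every time, and there are at most `n + 1` rounds.
      (fun s' => unmarked n (s'.arr 4) + s'.reg 34) ⟨hmarked, .inl h₂'⟩ ?_) ?_ ?_
    · intro s₃ hf₃ ⟨hM, hi⟩ hb
      have hs₃ : Ctx n G s₃ := hs₂.frame (by decide) hf₃
      have hb : s₃.reg 4 < s₃.reg 34 := hb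
      rw [hs₃.reg4] at hb
      have h34 : s₃.reg 34 = 1 := hi.resolve_right (by omega)
      refine Runs.seq (Runs.eval (p := .const 34 0) (Q := fun s' => s' = s₃.setReg 34 0)
        trivial rfl) fun s₄ hf₄ h₄ => ?_
      have hs₄ : Ctx n G s₄ := hs₃.frame (by decide) hf₄
      have e30 : s₄.reg 30 = s.reg 30 :=
        ((hf₄.reg 30 (by decide)).trans (hf₃.reg 30 (by decide))).trans h30
      have e31 : s₄.reg 31 = s.reg 31 :=
        ((hf₄.reg 31 (by decide)).trans (hf₃.reg 31 (by decide))).trans h31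
      have e3 : s₄.arr 3 = s.arr 3 :=
        ((hf₄.arr 3 (by decide)).trans (hf₃.arr 3 (by decide))).trans h3
      have e4 : s₄.arr 4 = s₃.arr 4 := hf₄.arr 4 (by decide)
      have hcol : s₄.col m 3 = s.col m 3 := by funext e; simp [State.col, e3]
      have := runs_markRound hs₄ (x := s.reg 11) (by rw [hcol, e30, e31, e4]; exact hM)
        (by rw [h₄]; simp [State.setReg])
      rw [hcol, e30, e31, e4, e3] at this
      refine Runs.mono this le_rfl ?_
      rintro s₅ - ⟨h5, ⟨h6, h7, h8⟩ | ⟨h6, h7⟩⟩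
      · refine ⟨⟨h5, .inr ⟨h6, by rw [h7]; exact h8⟩⟩, ?_⟩
        rw [h6, h7, h34]; omega
      · refine ⟨⟨h5, .inl h6⟩, ?_⟩
        rw [h6, h34]; omega
    · have : unmarked n (s₂.arr 4) ≤ n := (Finset.card_filter_le _ _).trans (by simp)
      rw [h₂']
      have := Nat.mul_le_mul_right (m * 24 + 4) (Nat.add_le_add_right this 1)
      have e : 1 + (m * 24 + 2) + 1 = m * 24 + 4 := by ring
      rw [e]
      omega
    · rintro s' hf' ⟨⟨hM, hi⟩, hb⟩ y hy
      have hb : ¬ s'.reg 4 < s'.reg 34 := hb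
      rw [(hs₂.frame (by decide) hf').reg4] at hb
      have hcl := (hi.resolve_left (by omega)).2
      refine ⟨fun h0 hKy => ?_, fun h => ?_⟩
      -- The last round changed nothing, so the marked set is closed under steps and contains the
      -- whole component.
      · have : ∀ z, K z → s'.arr 4 z ≠ 0 := by
          intro z hz
          induction hz with
          | refl => rw [hM.start]; simp
          | tail _ hst ih =>
            obtain ⟨e, he, hc⟩ := hst
            have := hcl e hc
            rcases he with ⟨rfl, rfl⟩ | ⟨rfl, rfl⟩
            · rwa [← this]
            · rwa [this]
        exact this y hKy h0
      · by_contra h0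
        exact h (hM.sound y hy h0)

end RAM

/-! ### Candidates and the exhaustive search -/

namespace RAM

variable {m n : ℕ} {G : EndMap ℕ (Fin m)} {s : State}

/-- Compute a candidate in the array `3` from the coloring in the array `2`. -/
def candProg : Prog :=
  .seq (copy 2 3) <| .seq (.seq (.store 3 10 4) <| .seq (.add 30 12 3) (.add 31 13 3)) <|
  .seq markProg <| .seq (.for 20 1 swapBody) <|
  .seq (.seq (.add 39 14 4) (.add 40 15 3)) <| .seq forceProg <|
  .seq (.seq (.add 39 16 4) (.add 40 17 3)) forceProg

/-- A bound for the number of steps of the computation of a candidate on an input of size `S`. -/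
def candTime (S : ℕ) : ℕ := 100 * S + 24 * (S + 1) * S + 4 * (S + 1) + 100

/-- The colors run through `0, 1, 2` in the registers of the loops, hence the shifts by one. -/
theorem runs_cand (hs : Ctx n G s) {g e f : Fin m} (hg : s.reg 10 = g) (hx : s.reg 11 < n)
    (he : s.reg 14 = e) (hf : s.reg 16 = f) :
    Runs candProg s (candTime (n + m)) (fun s' => s'.col m 3 = G.cand (s.col m 2) g (s.reg 11)
      (s.reg 12 + 1) (s.reg 13 + 1) e (s.reg 15 + 1) f (s.reg 17 + 1)) := by
  classical
  refine Runs.mono (B := (m * 4 + 2) + (3 + ((n * 3 + 2 + (2 + ((n + 1) * (m * 24 + 4) + 1))) +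
    ((m * 12 + 2) + (2 + ((m * 16 + 5) + (2 + (m * 16 + 5)))))))) (Q := fun s' =>
    s'.col m 3 = G.cand (s.col m 2) g (s.reg 11)
      (s.reg 12 + 1) (s.reg 13 + 1) e (s.reg 15 + 1) f (s.reg 17 + 1)) ?_ ?_ (fun _ _ h => h)
  swap
  · unfold candTime; nlinarith
  refine (runs_copy hs (by decide)).seq fun s₁ f₁ h₁ => ?_
  have hs₁ := hs.frame (by decide) f₁
  refine Runs.seq (Runs.eval (p := .seq (.store 3 10 4) <| .seq (.add 30 12 3) (.add 31 13 3))
    (Q := fun s' => s'.col m 3 = Function.update (s.col m 2) g 0 ∧ s'.reg 30 = s.reg 12 + 1 ∧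
      s'.reg 31 = s.reg 13 + 1) (by simp [Prog.LoopFree]) ?_) fun s₂ f₂ h₂ => ?_
  · have e10 := (f₁.reg 10 (by decide)).trans hg
    have e12 := f₁.reg 12 (by decide)
    have e13 := f₁.reg 13 (by decide)
    refine ⟨?_, ?_, ?_⟩
    · funext d
      have hd := congrFun h₁ d
      simp only [State.col, Prog.eval, State.setReg, State.setArr, Function.update_self, e10,
        hs₁.reg4] at hd ⊢
      by_cases hdg : d = g
      · simp [hdg]
      · rw [Function.update_of_ne (fun h => hdg (Fin.ext h)), Function.update_of_ne hdg, hd]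
        rfl
    · simp [Prog.eval, State.setReg, State.setArr, hs₁.reg3, e12]
    · simp [Prog.eval, State.setReg, State.setArr, hs₁.reg3, e13]
  obtain ⟨h₂, i₂, j₂⟩ := h₂
  have hs₂ := hs₁.frame (by decide) f₂
  have x₂ : s₂.reg 11 = s.reg 11 := (f₂.reg 11 (by decide)).trans (f₁.reg 11 (by decide))
  refine (runs_mark hs₂).seq fun s₃ f₃ h₃ => ?_
  rw [h₂, i₂, j₂, x₂] at h₃
  have hs₃ := hs₂.frame (by decide) f₃
  have c₃ : s₃.col m 3 = s₂.col m 3 := by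
    funext d; exact congrFun (f₃.arr 3 (by decide)) d
  have i₃ := (f₃.reg 30 (by decide)).trans i₂
  have j₃ := (f₃.reg 31 (by decide)).trans j₂
  refine (runs_swap hs₃ _ fun d => h₃ _ (hs.lt d).1).seq fun s₄ f₄ h₄ => ?_
  rw [c₃, h₂, i₃, j₃] at h₄
  have hs₄ := hs₃.frame (by decide) f₄
  have k₄ : ∀ r ∈ [14, 15, 16, 17], s₄.reg r = s.reg r := by
    intro r hr
    have h : ∀ r ∈ [14, 15, 16, 17], r ∉ (copy 2 3).regs ∧
      r ∉ (Prog.seq (.store 3 10 4) <| .seq (.add 30 12 3) (.add 31 13 3)).regs ∧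
      r ∉ markProg.regs ∧ r ∉ (Prog.for 20 1 swapBody).regs := by decide
    obtain ⟨a, b, c, d⟩ := h r hr
    rw [f₄.reg r d, f₃.reg r c, f₂.reg r b, f₁.reg r a]
  refine Runs.seq (Runs.eval (p := .seq (.add 39 14 4) (.add 40 15 3))
    (Q := fun s' => s'.reg 39 = e ∧ s'.reg 40 = s.reg 15 + 1) ⟨trivial, trivial⟩ ?_)
    fun s₅ f₅ h₅ => ?_
  · simp [Prog.eval, State.setReg, hs₄.reg3, hs₄.reg4, k₄, he]
  have hs₅ := hs₄.frame (by decide) f₅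
  have c₅ : s₅.col m 3 = s₄.col m 3 := by
    funext d; exact congrFun (f₅.arr 3 (by decide)) d
  refine (runs_forceProg hs₅ h₅.1).seq fun s₆ f₆ h₆ => ?_
  rw [c₅, h₄, h₅.2] at h₆
  have hs₆ := hs₅.frame (by decide) f₆
  have e16 : s₆.reg 16 = s.reg 16 := by
    rw [f₆.reg 16 (by decide), f₅.reg 16 (by decide), k₄ 16 (by simp)]
  have e17 : s₆.reg 17 = s.reg 17 := by
    rw [f₆.reg 17 (by decide), f₅.reg 17 (by decide), k₄ 17 (by simp)]
  refine Runs.seq (Runs.eval (p := .seq (.add 39 16 4) (.add 40 17 3))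
    (Q := fun s' => s'.reg 39 = f ∧ s'.reg 40 = s.reg 17 + 1) ⟨trivial, trivial⟩ ?_)
    fun s₇ f₇ h₇ => ?_
  · simp [Prog.eval, State.setReg, hs₆.reg3, hs₆.reg4, e16, e17, hf]
  have hs₇ := hs₆.frame (by decide) f₇
  have c₇ : s₇.col m 3 = s₆.col m 3 := by
    funext d; exact congrFun (f₇.arr 3 (by decide)) d
  refine Runs.mono (runs_forceProg hs₇ h₇.1) le_rfl fun s₈ f₈ h₈ => ?_
  rw [h₈, c₇, h₆, h₇.2, EndMap.cand]
  congr!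

/-- Replace the coloring in the array `2` by a candidate if this is cheaper, and set the register
`18` in this case. -/
def tryProg : Prog :=
  .seq candProg <| .seq (costProg 2 35) <| .seq (costProg 3 36) <|
    .cond (.lt 36 35) (.seq (copy 3 2) (.const 18 1)) .skip

theorem runs_try (hs : Ctx n G s) {g e f : Fin m} (hg : s.reg 10 = g) (hx : s.reg 11 < n)
    (he : s.reg 14 = e) (hf : s.reg 16 = f) {c' : Fin m → ℕ}
    (hc' : c' = G.cand (s.col m 2) g (s.reg 11) (s.reg 12 + 1) (s.reg 13 + 1) e (s.reg 15 + 1) f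
      (s.reg 17 + 1)) :
    Runs tryProg s (candTime (n + m) + (28 * m + 20)) (fun s' =>
      (s'.col m 2 = s.col m 2 ∧ s'.reg 18 = s.reg 18 ∧ G.cost (s.col m 2) ≤ G.cost c') ∨
      (s'.col m 2 = c' ∧ s'.reg 18 = 1 ∧ G.cost c' < G.cost (s.col m 2))) := by
  refine Runs.mono (B := candTime (n + m) + ((m * 12 + 3) + ((m * 12 + 3) + (m * 4 + 4)))) (Q :=
    fun s' =>
      (s'.col m 2 = s.col m 2 ∧ s'.reg 18 = s.reg 18 ∧ G.cost (s.col m 2) ≤ G.cost c') ∨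
      (s'.col m 2 = c' ∧ s'.reg 18 = 1 ∧ G.cost c' < G.cost (s.col m 2))) ?_ (by omega)
      fun _ _ h => h
  refine (runs_cand hs hg hx he hf).seq fun s₁ f₁ h₁ => ?_
  rw [← hc'] at h₁
  have hs₁ := hs.frame (by decide) f₁
  have c₁ : s₁.col m 2 = s.col m 2 := by funext d; exact congrFun (f₁.arr 2 (by decide)) d
  refine (runs_cost hs₁ (by decide)).seq fun s₂ f₂ h₂ => ?_
  rw [c₁] at h₂
  have hs₂ := hs₁.frame (by decide) f₂
  have c₂ : s₂.col m 3 = c' := by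
    rw [← h₁]; funext d; exact congrFun (f₂.arr 3 (by decide)) d
  refine (runs_cost hs₂ (by decide)).seq fun s₃ f₃ h₃ => ?_
  rw [c₂] at h₃
  have hs₃ := hs₂.frame (by decide) f₃
  have h35 := (f₃.reg 35 (by decide)).trans h₂
  have c₃ : s₃.col m 3 = c' := by
    rw [← c₂]; funext d; exact congrFun (f₃.arr 3 (by decide)) d
  have d₃ : s₃.col m 2 = s.col m 2 := by
    rw [← c₁]
    funext d
    exact congrFun ((f₃.arr 2 (by decide)).trans (f₂.arr 2 (by decide))) d
  have h18 : s₃.reg 18 = s.reg 18 := by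
    rw [f₃.reg 18 (by decide), f₂.reg 18 (by decide), f₁.reg 18 (by decide)]
  by_cases hb : s₃.reg 36 < s₃.reg 35
  · obtain ⟨s₄, t, he₄, ht, h₄, h₄'⟩ := (runs_copy hs₃ (a := 3) (b := 2) (by decide)).seq
      (q := .const 18 1) (B' := 1) (R := fun s' => s'.col m 2 = c' ∧ s'.reg 18 = 1)
      fun s' _ h => Runs.eval trivial ⟨by rw [← c₃, ← h]; rfl, by simp [Prog.eval, State.setReg]⟩
    refine ⟨s₄, t + 1, .cond_true hb he₄, by omega, .inr ⟨h₄, h₄', ?_⟩⟩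
    rwa [h₃, h35] at hb
  · refine ⟨s₃, 2, .cond_false hb (.skip _), by omega, .inl ⟨d₃, h18, ?_⟩⟩
    rw [h₃, h35] at hb
    exact not_lt.1 hb

/-- A program that searches for an improvement of the coloring in the array `2`: it either leaves
the coloring unchanged and establishes `Φ`, or it decreases the cost and sets the register `18`. -/
def Searches (n : ℕ) (G : EndMap ℕ (Fin m)) (p : Prog) (B : ℕ) (D : (ℕ → ℕ) → Prop)
    (Φ : (Fin m → ℕ) → (ℕ → ℕ) → Prop) : Prop :=
  ∀ s, Ctx n G s → G.Proper (s.col m 2) → D s.reg → Runs p s B fun s' => G.Proper (s'.col m 2) ∧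
    ((s'.col m 2 = s.col m 2 ∧ s'.reg 18 = s.reg 18 ∧ Φ (s.col m 2) s.reg) ∨
      (G.cost (s'.col m 2) < G.cost (s.col m 2) ∧ s'.reg 18 = 1))

/-- A predicate on the registers does not depend on those that `p` writes to. -/
def Indep (p : Prog) (D : (ℕ → ℕ) → Prop) : Prop :=
  ∀ r r' : ℕ → ℕ, (∀ k, k ∉ p.regs → r k = r' k) → D r → D r'

theorem Indep.for {p : Prog} {D : (ℕ → ℕ) → Prop} (hD : Indep p D) (x y N : ℕ) :
    Indep (.for x y p) (fun r => ∀ k < N, D (Function.update r x k)) := by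
  intro r r' h hr k hk
  refine hD _ _ (fun z hz => ?_) (hr k hk)
  by_cases hzx : z = x
  · simp [hzx]
  · rw [Function.update_of_ne hzx, Function.update_of_ne hzx]
    exact h z (by simp [Prog.for, Prog.regs, hz, hzx])

/-- A bound for the number of steps of a loop with at most `S + 3` rounds. -/
def loopTime (S B : ℕ) : ℕ := (S + 3) * (B + 2) + 2

/-- A pass goes on after an improvement, so the coloring may change between rounds. But an
improvement is never lost, and if there is none, all rounds saw the same coloring and their
conclusions `Φ` can be collected. `Indep` transports `D` and `Φ` between the actual registers and
those at the start. -/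
theorem Searches.for {p : Prog} {B x y N : ℕ} {D : (ℕ → ℕ) → Prop}
    {Φ : (Fin m → ℕ) → (ℕ → ℕ) → Prop} (hp : Searches n G p B D Φ) (hok : ForOk x y p)
    (hkeep : p.Keeps) (hx5 : 5 < x) (hx18 : x ≠ 18)
    (hyN : ∀ s, Ctx n G s → s.reg y = N) (hNS : N ≤ n + m + 3) (hD : Indep p D)
    (hΦ : ∀ c, Indep p (Φ c)) : Searches n G (.for x y p) (loopTime (n + m) B) (fun r => ∀ k < N, D (Function.update r x k))
      (fun c r => ∀ k < N, Φ c (Function.update r x k)) := by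
  intro s hs hc hDs
  refine Runs.mono (Runs.for (N := N) (B := B) hok (hyN s hs) hs.reg3 (fun k s' =>
    G.Proper (s'.col m 2) ∧ ((s'.col m 2 = s.col m 2 ∧ s'.reg 18 = s.reg 18 ∧
      ∀ k' < k, Φ (s.col m 2) (Function.update s.reg x k')) ∨
      (G.cost (s'.col m 2) < G.cost (s.col m 2) ∧ s'.reg 18 = 1))) ?_ ?_)
      (Nat.add_le_add_right (Nat.mul_le_mul_right _ hNS) 2) fun s' _ h => h.1
  · refine ⟨hc, .inl ⟨rfl, ?_, by simp⟩⟩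
    simp [State.setReg, hx18.symm]
  · intro k hk s' hr ha hx ⟨hc', hi⟩
    have hs' : Ctx n G s' := hs.frame' hkeep hx5 hr ha
    have hreg : ∀ r ∉ p.regs, Function.update s.reg x k r = s'.reg r := by
      intro r hrp
      by_cases hrx : r = x
      · rw [hrx, hx, Function.update_self]
      · rw [Function.update_of_ne hrx, hr r hrp hrx]
    have h18 : ∀ s'' : State, (s''.setReg x (k + 1)).reg 18 = s''.reg 18 := by
      intro s''; simp [State.setReg, hx18.symm]
    refine Runs.mono (hp s' hs' hc' (hD _ _ hreg (hDs k hk))) le_rfl ?_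
    rintro s'' - ⟨h1, h2⟩
    refine ⟨h1, ?_⟩
    rw [h18]
    change ((s''.col m 2 = _ ∧ _) ∨ (G.cost (s''.col m 2) < _ ∧ _))
    rcases h2 with ⟨h3, h4, h5⟩ | ⟨h3, h4⟩
    · rcases hi with ⟨h6, h7, h8⟩ | ⟨h6, h7⟩
      · refine .inl ⟨h3.trans h6, h4.trans h7, fun k' hk' => ?_⟩
        rcases Nat.lt_succ_iff_lt_or_eq.1 hk' with hk' | rfl
        · exact h8 k' hk'
        · rw [h6] at h5
          exact hΦ _ _ _ (fun r hrp => (hreg r hrp).symm) h5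
      · exact .inr ⟨h3 ▸ h6, h4.trans h7⟩
    · rcases hi with ⟨h6, -, -⟩ | ⟨h6, -⟩
      · exact .inr ⟨h6 ▸ h3, h4⟩
      · exact .inr ⟨h3.trans h6, h4⟩

theorem searches_try : Searches n G tryProg (candTime (n + m) + (28 * (n + m) + 20))
    (fun r => r 10 < m ∧ r 11 < n ∧ r 12 < 3 ∧ r 13 < 3 ∧ r 14 < m ∧ r 15 < 3 ∧ r 16 < m ∧ r 17 < 3)
    (fun c r => ∀ g e f : Fin m, r 10 = g → r 14 = e → r 16 = f →
      G.cost c ≤ G.cost (G.cand c g (r 11) (r 12 + 1) (r 13 + 1) e (r 15 + 1) f (r 17 + 1))) := by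
  rintro s hs hc ⟨hg, hx, hi, hj, he, ha, hf, hb⟩
  refine Runs.mono (runs_try hs (g := ⟨_, hg⟩) (e := ⟨_, he⟩) (f := ⟨_, hf⟩) rfl hx rfl rfl rfl)
    (by omega) ?_
  rintro s' - (⟨h1, h2, h3⟩ | ⟨h1, h2, h3⟩)
  · refine ⟨h1 ▸ hc, .inl ⟨h1, h2, ?_⟩⟩
    rintro ⟨g, hg⟩ ⟨e, he⟩ ⟨f, hf⟩ rfl rfl rfl
    exact h3
  · refine ⟨?_, .inr ⟨h1 ▸ h3, h2⟩⟩
    rw [h1]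
    exact EndMap.cand_proper hc ⟨by omega, by omega⟩ ⟨by omega, by omega⟩ (by omega) (by omega)

/-- Try all candidates. -/
def searchProg : Prog :=
  .for 10 1 <| .for 11 0 <| .for 12 2 <| .for 13 2 <| .for 14 1 <| .for 15 2 <| .for 16 1 <|
    .for 17 2 tryProg

/-- A bound for the number of steps of a search on an input of size `S`. -/
def searchTime (S : ℕ) : ℕ := (loopTime S)^[8] (candTime S + (28 * S + 20))

theorem searches_search : Searches n G searchProg (searchTime (n + m)) (fun _ => True)
    (fun c _ => ∀ g : Fin m, ∀ x < n, ∀ i < 3, ∀ j < 3, ∀ e : Fin m, ∀ a < 3, ∀ f : Fin m, ∀ b < 3,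
      G.cost c ≤ G.cost (G.cand c g x (i + 1) (j + 1) e (a + 1) f (b + 1))) := by
  have D0 : Indep tryProg (fun r => r 10 < m ∧ r 11 < n ∧ r 12 < 3 ∧ r 13 < 3 ∧ r 14 < m ∧
      r 15 < 3 ∧ r 16 < m ∧ r 17 < 3) := by
    intro r r' h
    simp only [h 10 (by decide), h 11 (by decide), h 12 (by decide), h 13 (by decide),
      h 14 (by decide), h 15 (by decide), h 16 (by decide), h 17 (by decide)]
    exact id
  have F0 : ∀ c, Indep tryProg (fun r => ∀ g e f : Fin m, r 10 = g → r 14 = e → r 16 = f →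
      G.cost c ≤ G.cost (G.cand c g (r 11) (r 12 + 1) (r 13 + 1) e (r 15 + 1) f (r 17 + 1))) := by
    intro c r r' h
    simp only [h 10 (by decide), h 11 (by decide), h 12 (by decide), h 13 (by decide),
      h 14 (by decide), h 15 (by decide), h 16 (by decide), h 17 (by decide)]
    exact id
  have P0 := searches_try (n := n) (G := G)
  have P1 := P0.for (x := 17) (y := 2) (by decide) (by decide) (by decide) (by decide)
    (fun _ h => h.reg2) (by omega) D0 F0
  have D1 := D0.for 17 2 3
  have F1 := fun c => (F0 c).for 17 2 3
  have P2 := P1.for (x := 16) (y := 1) (by decide) (by decide) (by decide) (by decide)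
    (fun _ h => h.reg1) (by omega) D1 F1
  have D2 := D1.for 16 1 m
  have F2 := fun c => (F1 c).for 16 1 m
  have P3 := P2.for (x := 15) (y := 2) (by decide) (by decide) (by decide) (by decide)
    (fun _ h => h.reg2) (by omega) D2 F2
  have D3 := D2.for 15 2 3
  have F3 := fun c => (F2 c).for 15 2 3
  have P4 := P3.for (x := 14) (y := 1) (by decide) (by decide) (by decide) (by decide)
    (fun _ h => h.reg1) (by omega) D3 F3
  have D4 := D3.for 14 1 m
  have F4 := fun c => (F3 c).for 14 1 m
  have P5 := P4.for (x := 13) (y := 2) (by decide) (by decide) (by decide) (by decide)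
    (fun _ h => h.reg2) (by omega) D4 F4
  have D5 := D4.for 13 2 3
  have F5 := fun c => (F4 c).for 13 2 3
  have P6 := P5.for (x := 12) (y := 2) (by decide) (by decide) (by decide) (by decide)
    (fun _ h => h.reg2) (by omega) D5 F5
  have D6 := D5.for 12 2 3
  have F6 := fun c => (F5 c).for 12 2 3
  have P7 := P6.for (x := 11) (y := 0) (by decide) (by decide) (by decide) (by decide)
    (fun _ h => h.reg0) (by omega) D6 F6
  have D7 := D6.for 11 0 n
  have F7 := fun c => (F6 c).for 11 0 n
  have P8 := P7.for (x := 10) (y := 1) (by decide) (by decide) (by decide) (by decide)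
    (fun _ h => h.reg1) (by omega) D7 F7
  intro s hs hc _
  refine Runs.mono (P8 s hs hc ?_) le_rfl ?_
  · intro g hg x hx i hi j hj e he a ha f hf b hb
    simp [*]
  · rintro s' - ⟨h1, h2⟩
    refine ⟨h1, h2.imp_left fun ⟨h3, h4, h5⟩ => ⟨h3, h4, ?_⟩⟩
    intro g x hx i hi j hj e a ha f b hb
    simpa using h5 g g.2 x hx i hi j hj e e.2 a ha f f.2 b hb g e f

end RAM

/-! ### The local search and its polynomial running time -/

namespace RAM

variable {m n : ℕ} {G : EndMap ℕ (Fin m)} {s : State}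

/-- Repeat the search for an improvement as long as it succeeds. -/
def improveProg : Prog :=
  .seq (.const 18 1) <| .loop (.lt 4 18) (.seq (.const 18 0) searchProg)

/-- The crude bound `deg ≤ m` suffices for the running time: an edge costs at most `6m + 1 + 2m`. -/
theorem cost_le (c : Fin m → ℕ) : G.cost c ≤ m * (8 * m + 1) := by
  have hdeg : ∀ x, G.deg x ≤ m := fun x => (Finset.card_le_univ _).trans (by simp)
  have h2 : (EndMap.uncolored c).card ≤ m := (Finset.card_le_univ _).trans (by simp)
  refine le_trans (Finset.sum_le_card_nsmul _ _ (8 * m + 1) fun e _ => ?_)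
    (Nat.mul_le_mul_right _ h2)
  have := hdeg (G.fst e)
  have := hdeg (G.snd e)
  simp only [Fintype.card_fin]
  omega

/-- A bound for the number of steps of all searches on an input of size `S`. -/
def improveTime (S : ℕ) : ℕ := (S * (8 * S + 1) + 1) * (searchTime S + 2) + 2

theorem runs_improve (hs : Ctx n G s) (hc : G.Proper (s.col m 2)) :
    Runs improveProg s (improveTime (n + m)) (fun s' => G.LocalOpt (s'.col m 2)) := by
  refine Runs.mono (B := 1 + ((m * (8 * m + 1) + 1) * (searchTime (n + m) + 2) + 1)) (Q :=
    fun s' => G.LocalOpt (s'.col m 2)) ?_ ?_ fun _ _ h => h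
  swap
  · have h1 : m * (8 * m + 1) ≤ (n + m) * (8 * (n + m) + 1) :=
      Nat.mul_le_mul (by omega) (by omega)
    have := Nat.mul_le_mul_right (searchTime (n + m) + 2) (Nat.add_le_add_right h1 1)
    unfold improveTime
    omega
  refine Runs.seq (Runs.eval (p := .const 18 1) (Q := fun s' => s' = s.setReg 18 1) trivial rfl)
    fun s₁ f₁ h₁ => ?_
  have hs₁ := hs.frame (by decide) f₁
  have h18 : s₁.reg 18 = 1 := by rw [h₁]; simp [State.setReg]
  have c₁ : s₁.col m 2 = s.col m 2 := by rw [h₁]; rfl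
  refine Runs.mono (Runs.loop (B := 1 + searchTime (n + m)) (fun s' => G.Proper (s'.col m 2) ∧
    (s'.reg 18 = 1 ∨ s'.reg 18 = 0 ∧ G.LocalOpt (s'.col m 2)))
    -- A successful pass lowers the cost and leaves the flag at 1; a failing pass keeps the cost,
    -- clears the flag and proves local optimality.
    (fun s' => G.cost (s'.col m 2) + s'.reg 18) ⟨by rw [c₁]; exact hc, .inl h18⟩ ?_) ?_ ?_
  · intro s₂ f₂ ⟨hc₂, hi⟩ hb
    have hs₂ := hs₁.frame (by decide) f₂
    have hb : s₂.reg 4 < s₂.reg 18 := hb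
    rw [hs₂.reg4] at hb
    have e18 : s₂.reg 18 = 1 := hi.resolve_right (by omega)
    refine Runs.seq (Runs.eval (p := .const 18 0) (Q := fun s' => s' = s₂.setReg 18 0) trivial rfl)
      fun s₃ f₃ h₃ => ?_
    have c₃ : s₃.col m 2 = s₂.col m 2 := by rw [h₃]; rfl
    have h0 : s₃.reg 18 = 0 := by rw [h₃]; simp [State.setReg]
    refine Runs.mono (searches_search s₃ (hs₂.frame (by decide) f₃) (by rwa [c₃]) trivial) le_rfl ?_
    rintro s₄ - ⟨h4, ⟨h5, h6, h7⟩ | ⟨h5, h6⟩⟩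
    · refine ⟨⟨h4, .inr ⟨h6.trans h0, h4, ?_⟩⟩, ?_⟩
      · rintro g x i j e a f b ⟨h, hx⟩ ⟨hi, hi'⟩ ⟨hj, hj'⟩ ⟨ha, ha'⟩ ⟨hb, hb'⟩
        have hxn : x < n := by
          rcases hx with rfl | rfl
          · exact (hs.lt h).1
          · exact (hs.lt h).2
        have := h7 g x hxn (i - 1) (by omega) (j - 1) (by omega) e (a - 1) (by omega) f (b - 1)
          (by omega)
        rw [Nat.sub_add_cancel hi, Nat.sub_add_cancel hj, Nat.sub_add_cancel ha,
          Nat.sub_add_cancel hb] at this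
        rwa [h5]
      · rw [h5, h6, h0, c₃, e18]; omega
    · refine ⟨⟨h4, .inl h6⟩, ?_⟩
      rw [h6, e18]
      rw [c₃] at h5
      omega
  · rw [h18]
    have := Nat.mul_le_mul_right (searchTime (n + m) + 2)
      (Nat.add_le_add_right (cost_le (G := G) (s₁.col m 2)) 1)
    have e : 1 + searchTime (n + m) + 1 = searchTime (n + m) + 2 := by ring
    rw [e]
    omega
  · rintro s' f' ⟨⟨-, hi⟩, hb⟩
    have hb : ¬ s'.reg 4 < s'.reg 18 := hb
    rw [(hs₁.frame (by decide) f').reg4] at hb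
    exact (hi.resolve_left (by omega)).2

/-- Count the edge in the register `20` in the degrees of its ends. -/
def degBody : Prog :=
  .seq (.seq (.load 21 0 20) <| .seq (.load 22 5 21) <| .seq (.add 22 22 3) (.store 5 21 22)) <|
  .seq (.load 21 1 20) <| .seq (.load 22 5 21) <| .seq (.add 22 22 3) (.store 5 21 22)

/-- The second increment reads the result of the first, so a loop would be counted twice; this is
why the ends must be distinct. -/
theorem degBody_arr (h3 : s.reg 3 = 1) (hne : s.arr 0 (s.reg 20) ≠ s.arr 1 (s.reg 20)) :
    (degBody.eval s).arr 5 = fun y => s.arr 5 y +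
      if s.arr 0 (s.reg 20) = y ∨ s.arr 1 (s.reg 20) = y then 1 else 0 := by
  funext y
  simp only [degBody, Prog.eval, State.setReg, State.setArr, Function.update_apply]
  norm_num [h3]
  grind

theorem runs_deg (h1 : s.reg 1 = m) (h3 : s.reg 3 = 1) (hA : ∀ e : Fin m, s.arr 0 e = G.fst e)
    (hB : ∀ e : Fin m, s.arr 1 e = G.snd e) (h5 : ∀ y, s.arr 5 y = 0) :
    Runs (.for 20 1 degBody) s (m * 10 + 2) (fun s' => ∀ y, s'.arr 5 y = G.deg y) := by
  classical
  set F : ℕ → ℕ → ℕ := fun y k => if h : k < m then (if G.Inc ⟨k, h⟩ y then 1 else 0) else 0 with hF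
  refine Runs.mono (Runs.for (N := m) (B := 8) (p := degBody) (by decide) h1 h3
    (fun k s' => ∀ y, s'.arr 5 y = ∑ i ∈ Finset.range k, F y i) ?_ ?_) le_rfl ?_
  · intro y
    rw [Finset.sum_range_zero]
    exact h5 y
  · intro k hk s' hr ha hx hi
    have hA' : s'.arr 0 k = G.fst ⟨k, hk⟩ := by rw [ha 0 (by decide)]; exact hA ⟨k, hk⟩
    have hB' : s'.arr 1 k = G.snd ⟨k, hk⟩ := by rw [ha 1 (by decide)]; exact hB ⟨k, hk⟩
    refine Runs.eval (p := degBody) (by simp [degBody, Prog.LoopFree]) fun y => ?_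
    change (degBody.eval s').arr 5 y = _
    rw [degBody_arr ((hr 3 (by decide) (by decide)).trans h3)
      (by rw [hx, hA', hB']; exact G.ne _), hx, hA', hB', Finset.sum_range_succ, ← hi]
    simp only [hF, hk, dif_pos, EndMap.Inc]
    congr
  · rintro s' - ⟨h, -⟩ y
    rw [h, Finset.sum_range, EndMap.deg, Finset.card_filter]
    refine Finset.sum_congr rfl fun e _ => ?_
    simp [hF]

/-- The whole algorithm. -/
def mainProg : Prog :=
  .seq (.seq (.const 2 3) <| .seq (.const 3 1) <| .seq (.add 5 1 1) <| .seq (.add 5 5 1) <|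
    .seq (.add 5 5 5) (.add 5 5 3)) <| .seq (.for 20 1 degBody) improveProg

theorem runs_main (I : EdgeList) (G : EndMap ℕ (Fin I.m)) (h1 : ∀ e, G.fst e = (I.ends e).1)
    (h2 : ∀ e, G.snd e = (I.ends e).2) :
    Runs mainProg (input I) (6 + (I.m * 10 + 2 + improveTime I.size))
      (fun s' => G.LocalOpt (s'.col I.m 2)) := by
  refine Runs.seq (Runs.eval (p := .seq (.const 2 3) <| .seq (.const 3 1) <| .seq (.add 5 1 1) <|
    .seq (.add 5 5 1) <| .seq (.add 5 5 5) (.add 5 5 3)) (Q := fun s' => s'.reg 0 = I.n ∧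
      s'.reg 1 = I.m ∧ s'.reg 2 = 3 ∧ s'.reg 3 = 1 ∧ s'.reg 4 = 0 ∧ s'.reg 5 = 6 * I.m + 1)
    (by simp [Prog.LoopFree]) ?_) fun s₁ f₁ ⟨r0, r1, r2, r3, r4, r5⟩ => ?_
  · simp [Prog.eval, State.setReg, input]
    ring
  have ha : s₁.arr = (input I).arr := by
    funext a; exact f₁.arr a (by simp [Prog.arrs])
  have hA : ∀ e : Fin I.m, s₁.arr 0 e = G.fst e := by
    intro e; rw [ha]; simp [input, h1]
  have hB : ∀ e : Fin I.m, s₁.arr 1 e = G.snd e := by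
    intro e; rw [ha]; simp [input, h2]
  refine (runs_deg r1 r3 hA hB (by intro y; rw [ha]; simp [input])).seq fun s₂ f₂ h₂ => ?_
  have hs₂ : Ctx I.n G s₂ := by
    constructor
    · rw [f₂.reg 0 (by decide), r0]
    · rw [f₂.reg 1 (by decide), r1]
    · rw [f₂.reg 2 (by decide), r2]
    · rw [f₂.reg 3 (by decide), r3]
    · rw [f₂.reg 4 (by decide), r4]
    · rw [f₂.reg 5 (by decide), r5]
    · rw [f₂.arr 0 (by decide)]; exact hA
    · rw [f₂.arr 1 (by decide)]; exact hB
    · exact fun x _ => h₂ x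
    · intro e
      rw [h1, h2]
      exact ⟨(I.ends e).1.2, (I.ends e).2.2⟩
  refine runs_improve hs₂ ?_
  -- Array `2` is initially zero, that is, the search starts from the empty coloring.
  have h0 : s₂.col I.m 2 = fun _ => 0 := by
    funext e
    simp only [State.col]
    rw [f₂.arr 2 (by decide), ha]
    simp [input]
  rw [h0]
  exact ⟨fun _ => by simp, fun _ _ _ _ _ _ _ => rfl⟩

/-- The number of steps of the algorithm is bounded by a polynomial. -/
theorem exists_polynomial : ∃ T : Polynomial ℕ, ∀ n m : ℕ,
    6 + (m * 10 + 2 + improveTime (n + m)) ≤ T.eval (n + m) := by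
  have hloop : ∀ k, ∀ P : Polynomial ℕ, ∃ Q : Polynomial ℕ, ∀ S,
      (loopTime S)^[k] (P.eval S) = Q.eval S := by
    intro k
    induction k with
    | zero => exact fun P => ⟨P, fun S => rfl⟩
    | succ k ih =>
      intro P
      -- One loop turns a polynomial time bound `P` into this polynomial; eight nested loops iterate
      -- it.
      obtain ⟨Q, hQ⟩ := ih ((Polynomial.X + 3) * (P + 2) + 2)
      refine ⟨Q, fun S => ?_⟩
      rw [← hQ, Function.iterate_succ_apply]
      congr 1
      simp [loopTime]
  open Polynomial in
  obtain ⟨Q, hQ⟩ := hloop 8 (100 * X + 24 * (X + 1) * X + 4 * (X + 1) + 100 + (28 * X + 20))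
  open Polynomial in
  refine ⟨6 + (X * 10 + 2 + ((X * (8 * X + 1) + 1) * (Q + 2) + 2)), fun n m => ?_⟩
  have h : searchTime (n + m) = Q.eval (n + m) := by
    rw [← hQ]
    unfold searchTime candTime
    congr 1
    simp
  simp only [improveTime, h, Polynomial.eval_add, Polynomial.eval_mul, Polynomial.eval_X,
    Polynomial.eval_ofNat, Polynomial.eval_one]
  omega

end RAM

/-! ### The algorithm on edge lists -/

namespace EdgeList

variable {I : EdgeList}

theorem inc_iff {e : Fin I.m} {x : Fin I.n} :
    I.toGraph.Inc e x ↔ (I.ends e).1 = x ∨ (I.ends e).2 = x := by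
  constructor
  · rintro ⟨y, h | h⟩ <;> simp [h]
  · rintro (h | h)
    · exact ⟨(I.ends e).2, .inl (by rw [← h])⟩
    · exact ⟨(I.ends e).1, .inr (by rw [← h])⟩

/-- The ends of the edges of a loopless edge list, as natural numbers. -/
def endMap (I : EdgeList) (hI : I.toGraph.Loopless) : EndMap ℕ (Fin I.m) where
  fst e := (I.ends e).1
  snd e := (I.ends e).2
  ne e h := hI.not_isLoopAt e (I.ends e).1 (.inl (Prod.ext rfl (Fin.ext h.symm)))

variable (hI : I.toGraph.Loopless)

theorem endMap_inc_iff {e : Fin I.m} {x : Fin I.n} :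
    (I.endMap hI).Inc e x ↔ I.toGraph.Inc e x := by
  rw [inc_iff, Fin.ext_iff, Fin.ext_iff]; rfl

theorem endMap_link_iff {e : Fin I.m} {x y : Fin I.n} :
    (I.endMap hI).Link e x y ↔ I.toGraph.IsLink e x y := by
  change _ ↔ I.ends e = (x, y) ∨ I.ends e = (y, x)
  simp only [Prod.ext_iff, Fin.ext_iff]
  rfl

theorem deg_endMap_le (h : I.toGraph.IsSubcubic) (x : ℕ) : (I.endMap hI).deg x ≤ 3 := by
  classical
  by_cases hx : x < I.n
  · have h1 := h ⟨x, hx⟩ (Set.mem_univ _)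
    have h2 : ((I.endMap hI).deg x : ℕ∞) = (I.toGraph.incidenceSet ⟨x, hx⟩).encard := by
      rw [EndMap.deg, ← Set.encard_coe_eq_coe_finsetCard]
      congr 1
      ext e
      simp [← endMap_inc_iff hI]
    have h3 : ((I.endMap hI).deg x : ℕ∞) ≤ 3 := by
      rw [h2]
      exact le_self_add.trans h1
    exact_mod_cast h3
  · have : (I.endMap hI).deg x = 0 := by
      rw [EndMap.deg, Finset.card_eq_zero, Finset.filter_eq_empty_iff]
      rintro e - (h | h)
      · exact hx (h ▸ (I.ends e).1.2)
      · exact hx (h ▸ (I.ends e).2.2)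
    omega

/-- The four edges exhaust all edges at `u`, `v`, `w`, so by connectedness no walk leaves these
three vertices. -/
theorem isIsomorphic_graphG3 (hc : I.toGraph.IsConnected) (h : (I.endMap hI).HasG3) :
    I.toGraph.IsIsomorphic graphG3 := by
  obtain ⟨u, v, w, e, h₀, h₁, h₂, he, hl0, hl1, hl2, h12, hall⟩ := h
  have hlt : ∀ {e x}, (I.endMap hI).Inc e x → x < I.n := by
    rintro e x (h | h)
    · exact h ▸ (I.ends e).1.2
    · exact h ▸ (I.ends e).2.2
  obtain ⟨u, rfl⟩ : ∃ u' : Fin I.n, (u' : ℕ) = u := ⟨⟨u, hlt he.left⟩, rfl⟩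
  obtain ⟨v, rfl⟩ : ∃ v' : Fin I.n, (v' : ℕ) = v := ⟨⟨v, hlt he.right⟩, rfl⟩
  obtain ⟨w, rfl⟩ : ∃ w' : Fin I.n, (w' : ℕ) = w := ⟨⟨w, hlt hl0.right⟩, rfl⟩
  have huv : u ≠ v := fun h => he.ne (by rw [h])
  have hvw : v ≠ w := fun h => hl0.ne (by rw [h])
  have hwu : w ≠ u := fun h => hl1.ne (by rw [h])
  simp only [endMap_inc_iff, endMap_link_iff] at he hl0 hl1 hl2 hall
  have hV : ∀ x, x = u ∨ x = v ∨ x = w := by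
    intro x
    induction hc.2 u (Set.mem_univ _) x (Set.mem_univ _) with
    | refl => exact .inl rfl
    | @tail y z _ hyz ih =>
      obtain ⟨f, hf⟩ := hyz
      have hfy : I.toGraph.Inc f u ∨ I.toGraph.Inc f v ∨ I.toGraph.Inc f w := by
        rcases ih with rfl | rfl | rfl
        · exact .inl hf.inc_left
        · exact .inr (.inl hf.inc_left)
        · exact .inr (.inr hf.inc_left)
      rcases hall f hfy with rfl | rfl | rfl | rfl
      · rcases hf.inc_right.eq_or_eq_of_isLink he with h | h <;> simp [h]
      · rcases hf.inc_right.eq_or_eq_of_isLink hl0 with h | h <;> simp [h]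
      · rcases hf.inc_right.eq_or_eq_of_isLink hl1 with h | h <;> simp [h]
      · rcases hf.inc_right.eq_or_eq_of_isLink hl2 with h | h <;> simp [h]
  have hE : ∀ f, f = e ∨ f = h₀ ∨ f = h₁ ∨ f = h₂ := by
    intro f
    refine hall f ?_
    have hf : I.toGraph.Inc f (I.ends f).1 := inc_iff.2 (.inl rfl)
    rcases hV (I.ends f).1 with h | h | h <;> rw [h] at hf <;> tauto
  have he0 : e ≠ h₀ := by
    rintro rfl; rcases he.inc_left.eq_or_eq_of_isLink hl0 with h | h
    · exact huv h
    · exact hwu h.symm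
  have he1 : e ≠ h₁ := by
    rintro rfl; rcases he.inc_right.eq_or_eq_of_isLink hl1 with h | h
    · exact hvw h
    · exact huv h.symm
  have he2 : e ≠ h₂ := by
    rintro rfl; rcases he.inc_right.eq_or_eq_of_isLink hl2 with h | h
    · exact hvw h
    · exact huv h.symm
  have h01 : h₀ ≠ h₁ := by
    rintro rfl; rcases hl0.inc_left.eq_or_eq_of_isLink hl1 with h | h
    · exact hvw h
    · exact huv h.symm
  have h02 : h₀ ≠ h₂ := by
    rintro rfl; rcases hl0.inc_left.eq_or_eq_of_isLink hl2 with h | h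
    · exact hvw h
    · exact huv h.symm
  -- The numbering matches `graphG3`: `h₀` joins `w = 0` to `v = 1`, `e` joins `v` to `u = 2`, and
  -- `h₁`, `h₂` are the doubled edge.
  let a : Fin 3 → Fin I.n := ![w, v, u]
  let b : Fin 4 → Fin I.m := ![h₀, e, h₁, h₂]
  have ha : Function.Bijective a := by
    constructor
    · intro i j hij
      fin_cases i <;> fin_cases j <;> simp [a] at hij ⊢ <;> grind
    · intro x
      rcases hV x with rfl | rfl | rfl
      · exact ⟨2, rfl⟩
      · exact ⟨1, rfl⟩
      · exact ⟨0, rfl⟩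
  have hb : Function.Bijective b := by
    constructor
    · intro i j hij
      fin_cases i <;> fin_cases j <;> simp [b] at hij ⊢ <;> grind
    · intro x
      rcases hE x with rfl | rfl | rfl | rfl
      · exact ⟨1, rfl⟩
      · exact ⟨0, rfl⟩
      · exact ⟨2, rfl⟩
      · exact ⟨3, rfl⟩
  have key : ∀ k : Fin 4, I.toGraph.IsLink (b k)
      (a ((![(0, 1), (1, 2), (2, 0), (2, 0)] : Fin 4 → Fin 3 × Fin 3) k).1)
      (a ((![(0, 1), (1, 2), (2, 0), (2, 0)] : Fin 4 → Fin 3 × Fin 3) k).2) := by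
    intro k
    fin_cases k
    · exact hl0.symm
    · exact he.symm
    · exact hl1.symm
    · exact hl2.symm
  have hlink : ∀ (k : Fin 4) (x y : Fin 3),
      I.toGraph.IsLink (b k) (a x) (a y) ↔ graphG3.IsLink k x y := by
    intro k x y
    rw [(key k).isLink_iff, ha.1.eq_iff, ha.1.eq_iff, ha.1.eq_iff, ha.1.eq_iff]
    change _ ↔ (![(0, 1), (1, 2), (2, 0), (2, 0)] : Fin 4 → Fin 3 × Fin 3) k = (x, y) ∨
      (![(0, 1), (1, 2), (2, 0), (2, 0)] : Fin 4 → Fin 3 × Fin 3) k = (y, x)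
    simp only [Prod.ext_iff]
  let φ : Fin I.n ≃ Fin 3 := (Equiv.ofBijective a ha).symm
  let ψ : Fin I.m ≃ Fin 4 := (Equiv.ofBijective b hb).symm
  refine ⟨(Equiv.Set.univ _).trans (φ.trans (Equiv.Set.univ _).symm),
    (Equiv.Set.univ _).trans (ψ.trans (Equiv.Set.univ _).symm), fun f x y => ?_⟩
  have h1 : ∀ x, a (φ x) = x := fun x => (Equiv.ofBijective a ha).apply_symm_apply x
  have h2 : ∀ f, b (ψ f) = f := fun f => (Equiv.ofBijective b hb).apply_symm_apply f
  have := hlink (ψ f) (φ x) (φ y)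
  rw [h1, h1, h2] at this
  exact this

/-- The algorithm finds a large `3`-edge-colorable subgraph. -/
theorem exists_exec (hI : I.toGraph.Loopless) (hc : I.toGraph.IsConnected)
    (h3 : I.toGraph.IsSubcubic) (hG3 : ¬ I.toGraph.IsIsomorphic graphG3) :
    ∃ (s : RAM.State) (t : ℕ), RAM.Exec RAM.mainProg (RAM.input I) s t ∧
      t ≤ 6 + (I.m * 10 + 2 + RAM.improveTime I.size) ∧
      ∃ H : Graph (Fin I.n) (Fin I.m), H ≤ I.toGraph ∧
        H.edgeSet = {e | RAM.output I s e ≠ 0} ∧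
        H.IsEdgeColoring 3 (RAM.output I s) ∧
        (7 / 9 : ℚ) * (I.toGraph.edgeSet.ncard : ℚ) ≤ (H.edgeSet.ncard : ℚ) := by
  classical
  obtain ⟨s, t, he, ht, hopt⟩ := RAM.runs_main I (I.endMap hI) (fun _ => rfl) (fun _ => rfl)
  have hcard := hopt.nine_mul_card_le (deg_endMap_le hI h3)
    (fun h => hG3 (isIsomorphic_graphG3 hI hc h))
  have hE : I.toGraph.edgeSet = Set.univ := rfl
  have hH : (I.toGraph.restrict {e | RAM.output I s e ≠ 0}).edgeSet =
      {e | RAM.output I s e ≠ 0} := by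
    rw [Graph.edgeSet_restrict, hE, Set.univ_inter]
  refine ⟨s, t, he, ht, I.toGraph.restrict {e | RAM.output I s e ≠ 0}, Graph.restrict_le, hH, ?_, ?_⟩
  · constructor
    · intro e hmem
      rw [hH] at hmem
      exact ⟨Nat.pos_of_ne_zero hmem, hopt.proper.1 e⟩
    · intro e f hef x hex hfx hcol
      rw [Graph.restrict_inc] at hex hfx
      exact hex.2 (hopt.proper.2 e f x hef ((endMap_inc_iff hI).2 hex.1)
        ((endMap_inc_iff hI).2 hfx.1) hcol)
  · rw [hH, hE, Set.ncard_univ, Nat.card_eq_fintype_card]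
    have h1 : {e | RAM.output I s e ≠ 0}.ncard = (Finset.univ.filter fun e : Fin I.m =>
        ¬ s.col I.m 2 e = 0).card := by
      rw [← Set.ncard_coe_finset]
      congr 1
      ext e
      rw [Finset.mem_coe, Finset.mem_filter]
      exact ⟨fun h => ⟨Finset.mem_univ _, h⟩, fun h => h.2⟩
    have h2 := Finset.card_filter_add_card_filter_not (s := (Finset.univ : Finset (Fin I.m)))
      (fun e => s.col I.m 2 e = 0)
    rw [Finset.card_univ] at h2
    rw [h1]
    have h4 : (EndMap.uncolored (s.col I.m 2)).card =
      (Finset.univ.filter fun e => s.col I.m 2 e = 0).card := rfl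
    have h5 : 7 * Fintype.card (Fin I.m) ≤ 9 * (Finset.univ.filter fun e : Fin I.m =>
        ¬ s.col I.m 2 e = 0).card := by omega
    have h6 : (7 : ℚ) * Fintype.card (Fin I.m) ≤ 9 * (Finset.univ.filter fun e : Fin I.m =>
        ¬ s.col I.m 2 e = 0).card := by exact_mod_cast h5
    linarith

end EdgeList

/-! ### Transfer to abstract finite multigraphs -/

namespace Graph

variable {α β : Type*} (G : Graph α β)

/-- A finite graph is described by an edge list. -/
theorem exists_edgeList (hV : G.vertexSet.Finite) (hE : G.edgeSet.Finite) :
    ∃ (I : EdgeList) (φ : G.vertexSet ≃ Fin I.n) (ψ : G.edgeSet ≃ Fin I.m),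
      ∀ (e : G.edgeSet) (x y : G.vertexSet), G.IsLink e x y ↔ I.toGraph.IsLink (ψ e) (φ x) (φ y) := by
  have := hV.to_subtype
  have := hE.to_subtype
  obtain ⟨n, ⟨φ⟩⟩ := Finite.exists_equiv_fin G.vertexSet
  obtain ⟨m, ⟨ψ⟩⟩ := Finite.exists_equiv_fin G.edgeSet
  have h : ∀ e : G.edgeSet, ∃ x y : G.vertexSet, G.IsLink e x y := by
    intro e
    obtain ⟨x, y, h⟩ := exists_isLink_of_mem_edgeSet e.2
    exact ⟨⟨x, h.left_mem⟩, ⟨y, h.right_mem⟩, h⟩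
  choose a b hab using h
  refine ⟨⟨n, m, fun k => (φ (a (ψ.symm k)), φ (b (ψ.symm k)))⟩, φ, ψ, fun e x y => ?_⟩
  change _ ↔ (φ (a (ψ.symm (ψ e))), φ (b (ψ.symm (ψ e)))) = (φ x, φ y) ∨
    (φ (a (ψ.symm (ψ e))), φ (b (ψ.symm (ψ e)))) = (φ y, φ x)
  rw [(hab e).isLink_iff, Equiv.symm_apply_apply]
  simp only [Prod.mk.injEq, EmbeddingLike.apply_eq_iff_eq, Subtype.ext_iff]

/-- All hypotheses are invariant under isomorphism, so the graph is replaced by an edge list and the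
output of the algorithm is pulled back. -/
theorem exists_large_subgraph (hV : G.vertexSet.Finite) (hE : G.edgeSet.Finite) (hL : G.Loopless)
    (hC : G.IsConnected) (hS : G.IsSubcubic) (hG3 : ¬ G.IsIsomorphic graphG3) :
    ∃ H : Graph α β, H ≤ G ∧ H.IsEdgeColorable 3 ∧
      (7 / 9 : ℚ) * (G.edgeSet.ncard : ℚ) ≤ (H.edgeSet.ncard : ℚ) := by
  classical
  obtain ⟨I, φ, ψ, hI⟩ := G.exists_edgeList hV hE
  have hlink : ∀ k x y, I.toGraph.IsLink k x y → G.IsLink (ψ.symm k) (φ.symm x) (φ.symm y) := by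
    intro k x y h
    rw [hI]
    simpa using h
  have hinc : ∀ e : G.edgeSet, ∀ x : G.vertexSet, G.Inc e x → I.toGraph.Inc (ψ e) (φ x) := by
    rintro e x ⟨y, h⟩
    exact ⟨φ ⟨y, h.right_mem⟩, (hI e x ⟨y, h.right_mem⟩).1 h⟩
  have hL' : I.toGraph.Loopless := ⟨fun e x h => hL.not_isLoopAt _ _ (hlink e x x h)⟩
  have hC' : I.toGraph.IsConnected := by
    refine ⟨⟨φ ⟨_, hC.1.some_mem⟩, Set.mem_univ _⟩, fun x _ y _ => ?_⟩
    have key : ∀ z, Relation.ReflTransGen G.Adj (φ.symm x) z → ∀ hz : z ∈ G.vertexSet,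
        Relation.ReflTransGen I.toGraph.Adj x (φ ⟨z, hz⟩) := by
      intro z h
      induction h with
      | refl => intro hz; simpa using Relation.ReflTransGen.refl
      | @tail b c _ hbc ih =>
        intro hz
        obtain ⟨e, he⟩ := hbc
        exact (ih he.left_mem).tail ⟨ψ ⟨e, he.edge_mem⟩,
          (hI ⟨e, he.edge_mem⟩ ⟨b, he.left_mem⟩ ⟨c, hz⟩).1 he⟩
    simpa using key (φ.symm y) (hC.2 _ (φ.symm x).2 _ (φ.symm y).2) (φ.symm y).2
  have hS' : I.toGraph.IsSubcubic := by
    intro x _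
    have h1 : (I.toGraph.loopSet x) = ∅ := by
      ext e
      simp
    have h2 : (I.toGraph.incidenceSet x).encard ≤ (G.incidenceSet (φ.symm x)).encard := by
      refine Set.encard_le_encard_of_injOn (f := fun k => (ψ.symm k : β)) ?_ ?_
      · rintro k ⟨y, h⟩
        exact ⟨_, hlink k x y h⟩
      · intro k _ l _ h
        exact ψ.symm.injective (Subtype.ext h)
    rw [vertexDegree, h1, Set.encard_empty, add_zero]
    exact (h2.trans le_self_add).trans (hS _ (φ.symm x).2)
  have hG3' : ¬ I.toGraph.IsIsomorphic graphG3 := by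
    rintro ⟨φ', ψ', h⟩
    refine hG3 ⟨φ.trans ((Equiv.Set.univ _).symm.trans φ'),
      ψ.trans ((Equiv.Set.univ _).symm.trans ψ'), fun e x y => ?_⟩
    rw [hI]
    exact h ⟨ψ e, Set.mem_univ _⟩ ⟨φ x, Set.mem_univ _⟩ ⟨φ y, Set.mem_univ _⟩
  obtain ⟨s, -, -, -, H, hHI, hHE, ⟨hcol, hcol'⟩, hcard⟩ := EdgeList.exists_exec hL' hC' hS' hG3'
  set c := RAM.output I s with hc
  set F : Set β := {e | ∃ h : e ∈ G.edgeSet, c (ψ ⟨e, h⟩) ≠ 0} with hF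
  have hFE : (G.restrict F).edgeSet = F := by
    rw [edgeSet_restrict, Set.inter_eq_right]
    exact fun e he => he.1
  have hIE : I.toGraph.edgeSet = Set.univ := rfl
  refine ⟨G.restrict F, restrict_le,
    ⟨fun e => if h : e ∈ G.edgeSet then c (ψ ⟨e, h⟩) else 0, ?_, ?_⟩, ?_⟩
  · intro e he
    rw [hFE] at he
    obtain ⟨h, he⟩ := he
    simp only [h, dif_pos]
    exact hcol _ (by rw [hHE]; exact he)
  · intro e f hef x hex hfx
    rw [restrict_inc] at hex hfx
    obtain ⟨hex, he, he0⟩ := hex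
    obtain ⟨hfx, hf, hf0⟩ := hfx
    simp only [he, hf, dif_pos]
    have hH : ∀ k y, I.toGraph.Inc k y → c k ≠ 0 → H.Inc k y := fun k y h h0 =>
      (hHI.inc_congr (by rw [hHE]; exact h0)).2 h
    refine hcol' _ _ (fun h => hef ?_) (φ ⟨x, hex.vertex_mem⟩)
      (hH _ _ (hinc ⟨e, he⟩ ⟨x, hex.vertex_mem⟩ hex) he0)
      (hH _ _ (hinc ⟨f, hf⟩ ⟨x, hex.vertex_mem⟩ hfx) hf0)
    exact congrArg Subtype.val (ψ.injective h)
  · have h1 : G.edgeSet.ncard = I.toGraph.edgeSet.ncard := by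
      rw [hIE, Set.ncard_univ, ← Nat.card_coe_set_eq]
      exact Nat.card_congr ψ
    have h2 : F.ncard = H.edgeSet.ncard := by
      refine Set.ncard_congr (fun e he => ψ ⟨e, he.1⟩) ?_ ?_ ?_
      · rintro e ⟨h, he⟩
        rw [hHE]
        exact he
      · intro e f _ _ h
        exact congrArg Subtype.val (ψ.injective h)
      · intro k hk
        rw [hHE] at hk
        exact ⟨ψ.symm k, ⟨(ψ.symm k).2, by simpa using hk⟩, by simp⟩
    rw [hFE, h1, h2]
    exact hcard

end Graph

theorem mainTheorem5 :
    (∀ {α β : Type*} (G : Graph α β), G.vertexSet.Finite → G.edgeSet.Finite → G.Loopless →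
      G.IsConnected → G.IsSubcubic → ¬ G.IsIsomorphic graphG3 →
      ∃ H : Graph α β, H ≤ G ∧ H.IsEdgeColorable 3 ∧
        (7 / 9 : ℚ) * (G.edgeSet.ncard : ℚ) ≤ (H.edgeSet.ncard : ℚ)) ∧
    (∃ (p : RAM.Prog) (T : Polynomial ℕ), ∀ I : EdgeList, I.toGraph.Loopless →
      I.toGraph.IsConnected → I.toGraph.IsSubcubic → ¬ I.toGraph.IsIsomorphic graphG3 →
      ∃ (s : RAM.State) (t : ℕ), RAM.Exec p (RAM.input I) s t ∧ t ≤ T.eval I.size ∧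
        ∃ H : Graph (Fin I.n) (Fin I.m), H ≤ I.toGraph ∧
          H.edgeSet = {e | RAM.output I s e ≠ 0} ∧
          H.IsEdgeColoring 3 (RAM.output I s) ∧
          (7 / 9 : ℚ) * (I.toGraph.edgeSet.ncard : ℚ) ≤ (H.edgeSet.ncard : ℚ)) := by
  refine ⟨fun G => G.exists_large_subgraph, ?_⟩
  obtain ⟨T, hT⟩ := RAM.exists_polynomial
  refine ⟨RAM.mainProg, T, fun I hL hC hS hG3 => ?_⟩
  obtain ⟨s, t, he, ht, h⟩ := EdgeList.exists_exec hL hC hS hG3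
  exact ⟨s, t, he, ht.trans (hT I.n I.m), h⟩
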